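/- Let $\alpha\in(0,1)$, $\beta\in(0,1/2]$, and put $$\alpha_c=\alpha_c(\beta)=\tfrac12\Bigl(1+\beta(1-\beta)-\sqrt{\beta(1-\beta)\,(2+\beta(1-\beta))}\Bigr).$$ Consider the infinite rooted binary tree of cells, in which every cell $v$ has one cell above left and one cell above right. Let all of the following variables be independent: for each cell $v$ a point contribution $X_v$ with $\mathbb P(X_v=1)=\alpha$ and $\mathbb P(X_v=-1)=1-\alpha$, and $\{0,1\}$-valued indicators $I_{v,L}$, $I_{v,R}$ with means $1-\beta$ and $\beta$, saying whether the cell above left, respectively above right, drains into $v$. The cells connected to the root $0$ by a path of draining edges form the drainage tree, a critical Bienaymé–Galton–Watson tree; let $H$ be its height. The runoff $W_v$ from a cell $v$ is $\lim_n W_v^{(n)}$, where $W_v^{(0)}=X_v\vee0$ and $W_v^{(n+1)}=(W^{(n)}_{v_L}I_{v,L}+W^{(n)}_{v_R}I_{v,R}+X_v)\vee 0$, with $v_L,v_R$ the cells above left and right of $v$. At the root write $W=W_0$, $W_L,W_R$ for the runoffs of the two cells above it, $I_L,I_R$ for their indicators, and define the net contribution $Y$ by $W=W_LI_L+W_RI_R+Y$.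 A node $v$ of the drainage tree contributes to the root runoff if $W_u>0$ for every node $u$ on the path from $v$ to the root, both ends included. Let $C$ be the largest generation of a contributing node ($C=0$ if there is none), the tree height contributing to root runoff. For $\delta>0$ let $E_\delta$ be the event that $H<\infty$ and some contributing node lies in generation at least $(1-\delta)H$, i.e. that the bottom $100(1-\delta)\%$ of the tree height contributes to root runoff. Almost surely, $H<\infty$ and all runoffs are finite, and $Y$ is integrable. Moreover: 1. If $\alpha>\alpha_c$, then $\mathbb E Y>0$, and for every $\delta>0$ there is an $\varepsilon>0$ such that $\mathbb P(E_\delta)\ge\varepsilon$ and $\mathbb P(E_\delta\mid H=n)\ge\varepsilon$ for every $n\ge0$. 2. If $\alpha\le\alpha_c$, then $\mathbb E Y=0$. 3. If $\alpha<\alpha_c$, then $\mathbb E\,C<\infty$, and moreover $\sup_{n\ge0}\mathbb E[\,C\mid H=n\,]<\infty$. -/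

import Mathlib

open MeasureTheory ProbabilityTheory
open scoped ENNReal

namespace Runoff

/-! Cells are words in `Bool`. The root is `[]`; the cells directly above `v` are `false :: v`
(above left) and `true :: v` (above right), so `v.length` is the generation of `v`, and the cells on
the path from `v` down to the root are exactly the suffixes of `v`.

In the deterministic definitions below, `x v` is the point contribution (rainfall minus infiltration)
of cell `v`, and `c v b ∈ {0, 1}` indicates whether the cell `b :: v` drains into the cell `v`. -/

/-- `v` is a node of the drainage tree of the root: every edge from `v` down to the root is open. -/
def InTree (c : List Bool → Bool → ℝ) : List Bool → Prop
  | [] => True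
  | b :: v => c v b = 1 ∧ InTree c v

/-- The runoff from cell `v` when the tree above `v` is truncated `n` generations above `v`. -/
noncomputable def truncRunoff (x : List Bool → ℝ) (c : List Bool → Bool → ℝ) :
    ℕ → List Bool → ℝ
  | 0, v => max (x v) 0
  | n + 1, v =>
      max (c v false * truncRunoff x c n (false :: v) + c v true * truncRunoff x c n (true :: v)
        + x v) 0

/-- The runoff `W_v` from cell `v`: the limit of the truncated runoffs, which is their supremum
since they are nondecreasing in `n`. The value may be infinite if the tree is infinite. -/
noncomputable def runoff (x : List Bool → ℝ) (c : List Bool → Bool → ℝ) (v : List Bool) : ℝ≥0∞ :=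
  ⨆ n : ℕ, ENNReal.ofReal (truncRunoff x c n v)

/-- The net contribution `Y = W - (W_L I_L + W_R I_R)` at the root. -/
noncomputable def netContribution (x : List Bool → ℝ) (c : List Bool → Bool → ℝ) : ℝ :=
  (runoff x c []).toReal
    - ((runoff x c [false]).toReal * c [] false + (runoff x c [true]).toReal * c [] true)

/-- The node `v` contributes to the runoff at the root: `v` is in the tree and the runoff is strictly
positive at every node of the path from `v` to the root, both ends included. -/
def Contributes (x : List Bool → ℝ) (c : List Bool → Bool → ℝ) (v : List Bool) : Prop :=
  InTree c v ∧ ∀ u : List Bool, u <:+ v → 0 < runoff x c u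

/-- The height of the drainage tree: the supremum of the generations of its nodes. -/
noncomputable def treeHeight (c : List Bool → Bool → ℝ) : ℕ∞ :=
  ⨆ (v : List Bool) (_ : InTree c v), (v.length : ℕ∞)

/-- The tree height contributing to root runoff: the supremum of the generations of the contributing
nodes (`0` if there are none). -/
noncomputable def contributingHeight (x : List Bool → ℝ) (c : List Bool → Bool → ℝ) : ℕ∞ :=
  ⨆ (v : List Bool) (_ : Contributes x c v), (v.length : ℕ∞)

/-- The bottom `100 (1 - δ) %` of the tree height contributes to root runoff: the tree has finite
height `n`, and some contributing node lies in generation at least `(1 - δ) n`. (All nodes on the path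
from that node to the root then contribute as well.) -/
def BottomContributes (x : List Bool → ℝ) (c : List Bool → Bool → ℝ) (δ : ℝ) : Prop :=
  ∃ n : ℕ, treeHeight c = n ∧ ∃ v : List Bool, Contributes x c v ∧ (1 - δ) * n ≤ v.length

/-- The critical point `α_c(β)`. -/
noncomputable def alphaC (β : ℝ) : ℝ :=
  (1 / 2) * (1 + β * (1 - β) - √(β * (1 - β) * (2 + β * (1 - β))))

/-- The random model with parameters `α`, `β`: the point contributions `X v` and the indicators
`I v b` are all independent, `X v` is `1` with probability `α` and `-1` with probability `1 - α`,
and the indicator of the edge above left (resp. right) has mean `1 - β` (resp. `β`). -/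
structure IsModel {Ω : Type*} [MeasurableSpace Ω] (P : Measure Ω) (α β : ℝ)
    (X : List Bool → Ω → ℝ) (I : List Bool → Bool → Ω → ℝ) : Prop where
  measurable_X : ∀ v, Measurable (X v)
  measurable_I : ∀ v b, Measurable (I v b)
  indep : iIndepFun (Sum.elim X (fun e : List Bool × Bool => I e.1 e.2)) P
  X_pos : ∀ v, P {ω | X v ω = 1} = ENNReal.ofReal α
  X_neg : ∀ v, P {ω | X v ω = -1} = ENNReal.ofReal (1 - α)
  left_open : ∀ v, P {ω | I v false ω = 1} = ENNReal.ofReal (1 - β)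
  left_closed : ∀ v, P {ω | I v false ω = 0} = ENNReal.ofReal β
  right_open : ∀ v, P {ω | I v true ω = 1} = ENNReal.ofReal β
  right_closed : ∀ v, P {ω | I v true ω = 0} = ENNReal.ofReal (1 - β)

end Runoff

namespace Runoff

/-! ### Finite decorated trees

A finite drainage tree is encoded as a `BinaryTree Bool`: a node carries `true` if its point
contribution is `1` and `false` if it is `-1`, and `nil` stands for a cell that is not connected. -/

/-! The drainage tree is almost surely finite, so everything reduces to sums over finite decorated
trees, truncated at `n` levels, whose probabilities are products over the nodes. Write b = β(1-β),
f(z) = z + b(1-z)² for `offspring`, G(s) = E s^W for `genLim`. Splitting at the root gives s G(s) =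
(αs²+1-α) f(G(s)) - (1-α)(1-s) f(G(0)) (`genLim_eq`). At s = 1 it forces G(1) = 1, that is,
finiteness. At s = 0 it is vacuous, so G(0), and with it E Y = 2α-1+(1-α) f(G(0)), must be found
indirectly.

The equation is a quadratic in 1-G(s) with E Y as a parameter (`genLim_quadratic`), and `rootSign`
is the signed square root of its discriminant. If E Y ≤ 0, dividing by (1-s)² and letting s → 1
yields (1-2α)² ≥ 4bα, which fails on (α_c, 1/2); for α ≥ 1/2 positivity is immediate
(`meanNet_pos`). If α ≤ α_c and E Y > 0, then `rootSign` would change sign on [0,1) although its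
square is positive there (`meanNet_eq_zero`).

For the conditional statements, follow a longest branch from the top down to the root.
P(H=n+1)/P(H=n) is a difference quotient of f tending to f'(1) = 1, and one step down multiplies the
mean of s^runoff by about E[s^X] f'(G(s)) while the runoff stays positive. Above α_c this factor is
below 1 for some s < 1: s^runoff behaves like a supermartingale starting a definite amount below 1,
while hitting zero costs at least 1, so the runoff survives to the root with probability bounded
below (`exists_reach`). Below α_c the same holds for some s > 1, with an exponential moment; then
the size of the contributing cluster, which bounds C, has bounded mean given H = n
(`exists_cluster_le`). -/

/-- The runoff from the root of a finite tree. -/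
def flow : BinaryTree Bool → ℕ
  | .nil => 0
  -- Truncated subtraction on `ℕ` plays the role of the positive part.
  | .node x l r => if x then flow l + flow r + 1 else flow l + flow r - 1

/-- The number of contributing nodes of a finite tree. -/
def cluster : BinaryTree Bool → ℕ
  | .nil => 0
  | .node x l r => if flow (.node x l r) = 0 then 0 else cluster l + cluster r + 1

/-- Some contributing node lies in generation `j`. -/
def Reaches : ℕ → BinaryTree Bool → Prop
  | 0, t => 0 < flow t
  | _ + 1, .nil => False
  | j + 1, .node x l r => 0 < flow (.node x l r) ∧ (Reaches j l ∨ Reaches j r)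

/-- The probability of a point contribution. -/
noncomputable def pointWeight (α : ℝ) (x : Bool) : ℝ := if x then α else 1 - α

/-- The probability that an edge of probability `p` carries the tree `t`, given the probability `w`
of `t`. -/
noncomputable def edgeWeight (p w : ℝ) (t : BinaryTree Bool) : ℝ :=
  (if t = .nil then 1 - p else 0) + p * w

/-- The probability that the tree of a cell is a given finite tree. -/
noncomputable def weight (α β : ℝ) : BinaryTree Bool → ℝ
  -- A cell always belongs to its own tree; `nil` gets mass only through a closed edge, in
  -- `edgeWeight`.
  | .nil => 0
  | .node x l r => pointWeight α x *
      (edgeWeight (1 - β) (weight α β l) l * edgeWeight β (weight α β r) r)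

/-- The trees with at most `n` levels. -/
def trees : ℕ → Finset (BinaryTree Bool)
  | 0 => {.nil}
  | n + 1 => insert .nil
      ((Finset.univ ×ˢ (trees n ×ˢ trees n)).image fun p => .node p.1 p.2.1 p.2.2)

theorem mem_trees {n : ℕ} {t : BinaryTree Bool} : t ∈ trees n ↔ t.height ≤ n := by
  induction n generalizing t with
  | zero => cases t <;> simp [trees]
  | succ n ih =>
    cases t with
    | nil => simp [trees]
    | node x l r => simp [trees, ih]

theorem nil_mem_trees (n : ℕ) : BinaryTree.nil ∈ trees n := mem_trees.2 (by simp)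

theorem trees_mono {m n : ℕ} (h : m ≤ n) : trees m ⊆ trees n := fun _ ht =>
  mem_trees.2 ((mem_trees.1 ht).trans h)

/-- The trees with exactly `n + 1` levels. -/
def level (n : ℕ) : Finset (BinaryTree Bool) := trees (n + 1) \ trees n

theorem mem_level {n : ℕ} {t : BinaryTree Bool} : t ∈ level n ↔ t.height = n + 1 := by
  simp only [level, Finset.mem_sdiff, mem_trees]; omega

instance : Countable (BinaryTree Bool) := by
  have h : (Set.univ : Set (BinaryTree Bool)) = ⋃ n : ℕ, (trees n : Set (BinaryTree Bool)) := by
    ext t; simpa using ⟨t.height, mem_trees.2 le_rfl⟩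
  exact Set.countable_univ_iff.1 (h ▸ Set.countable_iUnion fun n => (trees n).countable_toSet)

/-- The expectation of `φ` over the trees with at most `n` levels. -/
noncomputable def ex (α β : ℝ) (n : ℕ) (φ : BinaryTree Bool → ℝ) : ℝ :=
  ∑ t ∈ trees n, weight α β t * φ t

/-- The expectation of `φ` over the trees with exactly `n + 1` levels, that is, of height `n`. -/
noncomputable def exLevel (α β : ℝ) (n : ℕ) (φ : BinaryTree Bool → ℝ) : ℝ :=
  ∑ t ∈ level n, weight α β t * φ t

/-- A functional that factorizes at the root. -/
def nodeProd (h : Bool → ℝ) (u v : BinaryTree Bool → ℝ) : BinaryTree Bool → ℝ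
  | .nil => 0
  | .node x l r => h x * (u l * v r)

/-! ### Truncated expectations and their factorization at the root -/

section Weights

variable {α β : ℝ}

theorem pointWeight_nonneg (hα : 0 < α ∧ α < 1) (x : Bool) : 0 ≤ pointWeight α x := by
  unfold pointWeight; split <;> linarith [hα.1, hα.2]

theorem edgeWeight_nonneg {p w : ℝ} (hp : 0 ≤ p) (hp' : p ≤ 1) (hw : 0 ≤ w)
    (t : BinaryTree Bool) : 0 ≤ edgeWeight p w t := by
  unfold edgeWeight; have := mul_nonneg hp hw; split <;> linarith

theorem weight_nonneg (hα : 0 < α ∧ α < 1) (hβ : 0 < β ∧ β ≤ 1 / 2) (t : BinaryTree Bool) :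
    0 ≤ weight α β t := by
  induction t with
  | nil => simp [weight]
  | node x l r hl hr =>
    exact mul_nonneg (pointWeight_nonneg hα x)
      (mul_nonneg (edgeWeight_nonneg (by linarith) (by linarith) hl l)
        (edgeWeight_nonneg (by linarith) (by linarith) hr r))

theorem ex_zero (φ : BinaryTree Bool → ℝ) : ex α β 0 φ = 0 := by simp [ex, trees, weight]

theorem ex_succ (n : ℕ) (φ : BinaryTree Bool → ℝ) :
    ex α β (n + 1) φ = ∑ x, ∑ l ∈ trees n, ∑ r ∈ trees n, pointWeight α x *
      (edgeWeight (1 - β) (weight α β l) l * edgeWeight β (weight α β r) r) *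
        φ (.node x l r) := by
  rw [ex, trees, Finset.sum_insert (by simp), Finset.sum_image, Finset.sum_product]
  · simp only [weight, zero_mul, zero_add]
    exact Finset.sum_congr rfl fun x _ => by rw [Finset.sum_product]
  · rintro ⟨x, l, r⟩ _ ⟨x', l', r'⟩ _ h
    simpa using h

theorem ex_succ_eq_add (n : ℕ) (φ : BinaryTree Bool → ℝ) :
    ex α β (n + 1) φ = ex α β n φ + exLevel α β n φ := by
  rw [ex, ex, exLevel, level, ← Finset.sum_sdiff (trees_mono n.le_succ), add_comm]

/-- A longest branch runs through the left subtree, the right one being no taller, or through the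
right subtree, the left one being strictly shorter. Ties go left, so no tree is counted twice. -/
theorem exLevel_succ (n : ℕ) (φ : BinaryTree Bool → ℝ) :
    exLevel α β (n + 1) φ =
      ∑ x, (∑ l ∈ level n, ∑ r ∈ trees (n + 1), pointWeight α x *
        (edgeWeight (1 - β) (weight α β l) l * edgeWeight β (weight α β r) r) *
          φ (.node x l r) +
       ∑ l ∈ trees n, ∑ r ∈ level n, pointWeight α x *
        (edgeWeight (1 - β) (weight α β l) l * edgeWeight β (weight α β r) r) *
          φ (.node x l r)) := by
  have h : exLevel α β (n + 1) φ = ex α β (n + 2) φ - ex α β (n + 1) φ := by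
    rw [ex_succ_eq_add (n + 1)]; ring
  rw [h, ex_succ, ex_succ, ← Finset.sum_sub_distrib]
  refine Finset.sum_congr rfl fun x _ => ?_
  rw [← Finset.sum_sdiff (trees_mono n.le_succ), add_sub_assoc, ← Finset.sum_sub_distrib, level]
  congr 1
  refine Finset.sum_congr rfl fun l _ => ?_
  rw [← Finset.sum_sdiff (trees_mono n.le_succ) (f := fun r => pointWeight α x *
        (edgeWeight (1 - β) (weight α β l) l * edgeWeight β (weight α β r) r) *
          φ (.node x l r)), add_sub_cancel_right]

theorem sum_product_weights (S T : Finset (BinaryTree Bool)) (h : Bool → ℝ)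
    (u v : BinaryTree Bool → ℝ) :
    ∑ x, ∑ l ∈ S, ∑ r ∈ T, pointWeight α x *
      (edgeWeight (1 - β) (weight α β l) l * edgeWeight β (weight α β r) r) *
        (h x * (u l * v r)) =
    (α * h true + (1 - α) * h false) *
      ((∑ l ∈ S, edgeWeight (1 - β) (weight α β l) l * u l) *
        ∑ r ∈ T, edgeWeight β (weight α β r) r * v r) := by
  have : α * h true + (1 - α) * h false = ∑ x, pointWeight α x * h x := by
    simp [pointWeight]
  rw [this, Finset.sum_mul_sum, Finset.sum_mul]
  refine Finset.sum_congr rfl fun x _ => ?_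
  rw [Finset.mul_sum]
  refine Finset.sum_congr rfl fun l _ => ?_
  rw [Finset.mul_sum]
  exact Finset.sum_congr rfl fun r _ => by ring

theorem sum_edgeWeight_trees (p : ℝ) (n : ℕ) (u : BinaryTree Bool → ℝ) :
    ∑ t ∈ trees n, edgeWeight p (weight α β t) t * u t = (1 - p) * u .nil + p * ex α β n u := by
  simp only [edgeWeight, add_mul, Finset.sum_add_distrib, ite_mul, zero_mul]
  rw [Finset.sum_ite_eq' (trees n) BinaryTree.nil, if_pos (nil_mem_trees n), ex, Finset.mul_sum]
  simp only [mul_assoc]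

theorem sum_edgeWeight_level (p : ℝ) (n : ℕ) (u : BinaryTree Bool → ℝ) :
    ∑ t ∈ level n, edgeWeight p (weight α β t) t * u t = p * exLevel α β n u := by
  rw [exLevel, Finset.mul_sum]
  refine Finset.sum_congr rfl fun t ht => ?_
  have : t ≠ .nil := by rintro rfl; simpa using mem_level.1 ht
  simp [edgeWeight, this, mul_assoc]

theorem ex_congr_node (n : ℕ) {φ ψ : BinaryTree Bool → ℝ}
    (h : ∀ x l r, φ (.node x l r) = ψ (.node x l r)) : ex α β n φ = ex α β n ψ :=
  Finset.sum_congr rfl fun t _ => by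
    cases t with
    | nil => simp [weight]
    | node x l r => rw [h]

theorem ex_succ_nodeProd (n : ℕ) (h : Bool → ℝ) (u v : BinaryTree Bool → ℝ) :
    ex α β (n + 1) (nodeProd h u v) = (α * h true + (1 - α) * h false) *
      ((β * u .nil + (1 - β) * ex α β n u) * ((1 - β) * v .nil + β * ex α β n v)) := by
  simp only [ex_succ, nodeProd]
  rw [sum_product_weights, sum_edgeWeight_trees, sum_edgeWeight_trees, sub_sub_cancel]

theorem ex_add (n : ℕ) (φ ψ : BinaryTree Bool → ℝ) :
    ex α β n (fun t => φ t + ψ t) = ex α β n φ + ex α β n ψ := by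
  simp [ex, mul_add, Finset.sum_add_distrib]

theorem ex_const_mul (n : ℕ) (c : ℝ) (φ : BinaryTree Bool → ℝ) :
    ex α β n (fun t => c * φ t) = c * ex α β n φ := by
  simp only [ex, Finset.mul_sum]; exact Finset.sum_congr rfl fun t _ => by ring

theorem exLevel_add (n : ℕ) (φ ψ : BinaryTree Bool → ℝ) :
    exLevel α β n (fun t => φ t + ψ t) = exLevel α β n φ + exLevel α β n ψ := by
  simp [exLevel, mul_add, Finset.sum_add_distrib]

theorem exLevel_eq_sub (n : ℕ) (φ : BinaryTree Bool → ℝ) :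
    exLevel α β n φ = ex α β (n + 1) φ - ex α β n φ := by rw [ex_succ_eq_add]; ring

variable (hα : 0 < α ∧ α < 1) (hβ : 0 < β ∧ β ≤ 1 / 2)
include hα hβ

theorem ex_mono (n : ℕ) {φ ψ : BinaryTree Bool → ℝ}
    (h : ∀ t, φ t ≤ ψ t) : ex α β n φ ≤ ex α β n ψ :=
  Finset.sum_le_sum fun t _ => mul_le_mul_of_nonneg_left (h t) (weight_nonneg hα hβ t)

theorem ex_mono_node (n : ℕ) {φ ψ : BinaryTree Bool → ℝ}
    (h : ∀ x l r, φ (.node x l r) ≤ ψ (.node x l r)) : ex α β n φ ≤ ex α β n ψ :=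
  Finset.sum_le_sum fun t _ => by
    cases t with
    | nil => simp [weight]
    | node x l r => exact mul_le_mul_of_nonneg_left (h x l r) (weight_nonneg hα hβ _)

theorem ex_nonneg (n : ℕ) {φ : BinaryTree Bool → ℝ} (h : ∀ t, 0 ≤ φ t) : 0 ≤ ex α β n φ :=
  Finset.sum_nonneg fun t _ => mul_nonneg (weight_nonneg hα hβ t) (h t)

theorem exLevel_nonneg (n : ℕ) {φ : BinaryTree Bool → ℝ} (h : ∀ t, 0 ≤ φ t) :
    0 ≤ exLevel α β n φ :=
  Finset.sum_nonneg fun t _ => mul_nonneg (weight_nonneg hα hβ t) (h t)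

theorem exLevel_mono (n : ℕ) {φ ψ : BinaryTree Bool → ℝ}
    (h : ∀ t, φ t ≤ ψ t) : exLevel α β n φ ≤ exLevel α β n ψ :=
  Finset.sum_le_sum fun t _ => mul_le_mul_of_nonneg_left (h t) (weight_nonneg hα hβ t)

theorem exLevel_mono_node (n : ℕ) {φ ψ : BinaryTree Bool → ℝ}
    (h : ∀ x l r, φ (.node x l r) ≤ ψ (.node x l r)) : exLevel α β n φ ≤ exLevel α β n ψ :=
  Finset.sum_le_sum fun t _ => by
    cases t with
    | nil => simp [weight]
    | node x l r => exact mul_le_mul_of_nonneg_left (h x l r) (weight_nonneg hα hβ _)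

theorem ex_le_ex_of_le {m n : ℕ} (hmn : m ≤ n) {φ : BinaryTree Bool → ℝ} (h : ∀ t, 0 ≤ φ t) :
    ex α β m φ ≤ ex α β n φ :=
  Finset.sum_le_sum_of_subset_of_nonneg (trees_mono hmn) fun t _ _ =>
    mul_nonneg (weight_nonneg hα hβ t) (h t)

end Weights

open Filter Topology

/-! ### The generating function of the runoff -/

/-- The generating function of the number of draining edges into a cell. -/
noncomputable def offspring (β z : ℝ) : ℝ := (β + (1 - β) * z) * (1 - β + β * z)

/-- The generating function of the runoff on the event that the tree has at most `n` levels. -/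
noncomputable def gen (α β : ℝ) (n : ℕ) (s : ℝ) : ℝ := ex α β n fun t => s ^ flow t

/-- The generating function of the runoff. -/
noncomputable def genLim (α β s : ℝ) : ℝ := ⨆ n, gen α β n s

section

variable {α β : ℝ}

theorem offspring_eq (β z : ℝ) : offspring β z = z + β * (1 - β) * (1 - z) ^ 2 := by
  unfold offspring; ring

theorem gen_zero (s : ℝ) : gen α β 0 s = 0 := ex_zero _

theorem gen_succ (n : ℕ) (s : ℝ) :
    s * gen α β (n + 1) s = (α * s ^ 2 + (1 - α)) * offspring β (gen α β n s) -
      (1 - α) * (1 - s) * offspring β (gen α β n 0) := by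
  -- For contribution -1 and inflow m, s·s^{(m-1)⁺} = s^m + (s-1)·0^m: the positive part costs a
  -- correction seen only at m = 0, hence the value of `gen` at 0.
  have key : ∀ x l r, s * s ^ flow (.node x l r) =
      nodeProd (fun x => if x then s ^ 2 else 1) (fun t => s ^ flow t) (fun t => s ^ flow t)
        (.node x l r) +
      nodeProd (fun x => if x then 0 else s - 1) (fun t => 0 ^ flow t) (fun t => 0 ^ flow t)
        (.node x l r) := by
    intro x l r
    cases x
    · simp only [nodeProd, flow, Bool.false_eq_true, if_false, one_mul]
      rcases Nat.eq_zero_or_pos (flow l + flow r) with h | h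
      · have h1 : flow l = 0 := by omega
        have h2 : flow r = 0 := by omega
        simp [h1, h2]
      · rw [← pow_add, ← pow_add, zero_pow h.ne', ← pow_succ', Nat.sub_add_cancel h]
        ring
    · simp [nodeProd, flow]; ring
  rw [gen, ← ex_const_mul, ex_congr_node (ψ := fun t => nodeProd _ _ _ t + nodeProd _ _ _ t) _ key,
    ex_add, ex_succ_nodeProd, ex_succ_nodeProd]
  simp only [flow, gen, offspring, pow_zero, if_true, Bool.false_eq_true, if_false]
  ring

theorem gen_one_succ (n : ℕ) : gen α β (n + 1) 1 = offspring β (gen α β n 1) := by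
  have := gen_succ (α := α) (β := β) n 1
  simpa using this

/-- The probability of height n is the increment of `gen` at 1, so the ratio of consecutive ones is
a difference quotient of the quadratic `offspring`. -/
theorem level_one_succ (n : ℕ) : exLevel α β (n + 1) (fun _ => 1) =
    (1 - 2 * (β * (1 - β)) + β * (1 - β) * (gen α β (n + 1) 1 + gen α β n 1)) *
      exLevel α β n (fun _ => 1) := by
  have h (n) : exLevel α β n (fun _ => 1) = gen α β (n + 1) 1 - gen α β n 1 := by
    simp [exLevel_eq_sub, gen]
  rw [h, h, gen_one_succ (n + 1), gen_one_succ n, offspring_eq, offspring_eq]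
  ring

theorem offspring_mono (hβ : 0 < β ∧ β ≤ 1 / 2) {z w : ℝ} (hz : 0 ≤ z) (hzw : z ≤ w) :
    offspring β z ≤ offspring β w := by
  have h0 : 0 ≤ β := hβ.1.le
  have h1 : 0 ≤ 1 - β := by linarith [hβ.2]
  have h2 : 0 ≤ β + (1 - β) * w := by have := hz.trans hzw; positivity
  unfold offspring
  gcongr

theorem offspring_pos (hβ : 0 < β ∧ β ≤ 1 / 2) {z : ℝ} (hz : 0 ≤ z) : 0 < offspring β z := by
  have h0 : 0 < β := hβ.1
  have h1 : 0 < 1 - β := by linarith [hβ.2]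
  unfold offspring; positivity

variable (hα : 0 < α ∧ α < 1) (hβ : 0 < β ∧ β ≤ 1 / 2)
include hα hβ

theorem gen_nonneg (n : ℕ) {s : ℝ} (hs : 0 ≤ s) : 0 ≤ gen α β n s :=
  ex_nonneg hα hβ n fun _ => pow_nonneg hs _

theorem gen_le_one_arg (n : ℕ) {s : ℝ} (hs : 0 ≤ s) (hs' : s ≤ 1) :
    gen α β n s ≤ gen α β n 1 :=
  ex_mono hα hβ n fun _ => by rw [one_pow]; exact pow_le_one₀ hs hs'

theorem gen_one_le (n : ℕ) : gen α β n 1 ≤ 1 := by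
  induction n with
  | zero => simp [gen_zero]
  | succ n ih =>
    rw [gen_one_succ]
    refine (offspring_mono hβ (gen_nonneg hα hβ n zero_le_one) ih).trans ?_
    unfold offspring; linarith

theorem gen_le_one (n : ℕ) {s : ℝ} (hs : 0 ≤ s) (hs' : s ≤ 1) : gen α β n s ≤ 1 :=
  (gen_le_one_arg hα hβ n hs hs').trans (gen_one_le hα hβ n)

theorem gen_monotone {s : ℝ} (hs : 0 ≤ s) : Monotone fun n => gen α β n s := fun _ _ h =>
  ex_le_ex_of_le hα hβ h fun _ => pow_nonneg hs _

theorem tendsto_gen {s : ℝ} (hs : 0 ≤ s) (hs' : s ≤ 1) :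
    Tendsto (fun n => gen α β n s) atTop (𝓝 (genLim α β s)) :=
  tendsto_atTop_ciSup (gen_monotone hα hβ hs)
    ⟨1, by rintro _ ⟨n, rfl⟩; exact gen_le_one hα hβ n hs hs'⟩

theorem gen_le_genLim (n : ℕ) {s : ℝ} (hs : 0 ≤ s) (hs' : s ≤ 1) :
    gen α β n s ≤ genLim α β s :=
  (gen_monotone hα hβ hs).ge_of_tendsto (tendsto_gen hα hβ hs hs') n

theorem genLim_nonneg {s : ℝ} (hs : 0 ≤ s) (hs' : s ≤ 1) : 0 ≤ genLim α β s :=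
  (gen_nonneg hα hβ 0 hs).trans (gen_le_genLim hα hβ 0 hs hs')

theorem genLim_le_one {s : ℝ} (hs : 0 ≤ s) (hs' : s ≤ 1) : genLim α β s ≤ 1 :=
  le_of_tendsto' (tendsto_gen hα hβ hs hs') fun n => gen_le_one hα hβ n hs hs'

omit hα hβ in
theorem continuous_offspring : Continuous (offspring β) := by unfold offspring; fun_prop

theorem genLim_eq {s : ℝ} (hs : 0 ≤ s) (hs' : s ≤ 1) :
    s * genLim α β s = (α * s ^ 2 + (1 - α)) * offspring β (genLim α β s) -
      (1 - α) * (1 - s) * offspring β (genLim α β 0) := by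
  have h1 := ((tendsto_gen hα hβ hs hs').comp (tendsto_add_atTop_nat 1)).const_mul s
  have h2 := (((continuous_offspring (β := β)).tendsto _).comp
    (tendsto_gen hα hβ hs hs')).const_mul (α * s ^ 2 + (1 - α))
  have h3 := (((continuous_offspring (β := β)).tendsto _).comp
    (tendsto_gen hα hβ le_rfl zero_le_one)).const_mul ((1 - α) * (1 - s))
  exact tendsto_nhds_unique h1 ((h2.sub h3).congr fun n => (gen_succ n s).symm)

/-- Criticality: f(z) - z = b(1-z)² vanishes only at z = 1. -/
theorem genLim_one : genLim α β 1 = 1 := by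
  have h := genLim_eq hα hβ zero_le_one le_rfl
  rw [offspring_eq] at h
  have h1 : β * (1 - β) * (1 - genLim α β 1) ^ 2 = 0 := by linarith
  have h2 : β * (1 - β) ≠ 0 := by
    have := hβ.1; have : 0 < 1 - β := by linarith [hβ.2]
    positivity
  have h3 := pow_eq_zero_iff (two_ne_zero) |>.1 ((mul_eq_zero.1 h1).resolve_left h2)
  linarith

theorem tendsto_gen_one : Tendsto (fun n => gen α β n 1) atTop (𝓝 1) := by
  simpa [genLim_one hα hβ] using tendsto_gen hα hβ zero_le_one le_rfl

theorem gen_sub_gen_le {m n : ℕ} (h : n ≤ m) {s : ℝ} (hs : 0 ≤ s) (hs' : s ≤ 1) :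
    gen α β m s - gen α β n s ≤ gen α β m 1 - gen α β n 1 := by
  have key (φ : BinaryTree Bool → ℝ) :
      ex α β m φ - ex α β n φ = ∑ t ∈ trees m \ trees n, weight α β t * φ t := by
    rw [ex, ex, ← Finset.sum_sdiff (trees_mono h)]; ring
  rw [gen, gen, gen, gen, key, key]
  exact Finset.sum_le_sum fun t _ => mul_le_mul_of_nonneg_left
    (by rw [one_pow]; exact pow_le_one₀ hs hs') (weight_nonneg hα hβ t)

/-- A uniform limit of polynomials: at every s in [0,1] the truncation error is at most the
probability of more than n levels. -/
theorem continuousOn_genLim : ContinuousOn (genLim α β) (Set.Icc 0 1) := by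
  have hu : TendstoUniformlyOn (fun n s => gen α β n s) (genLim α β) atTop (Set.Icc 0 1) := by
    rw [Metric.tendstoUniformlyOn_iff]
    intro ε hε
    filter_upwards [(tendsto_gen_one hα hβ).eventually (lt_mem_nhds (sub_lt_self 1 hε))]
      with n hn s hs
    have h1 : genLim α β s - gen α β n s ≤ 1 - gen α β n 1 :=
      le_of_tendsto_of_tendsto ((tendsto_gen hα hβ hs.1 hs.2).sub_const _)
        ((tendsto_gen_one hα hβ).sub_const _)
        (eventually_atTop.2 ⟨n, fun m hm => gen_sub_gen_le hα hβ hm hs.1 hs.2⟩)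
    rw [Real.dist_eq, abs_of_nonneg (sub_nonneg.2 (gen_le_genLim hα hβ n hs.1 hs.2))]
    linarith
  refine hu.continuousOn (Frequently.of_forall fun n => ?_)
  unfold gen ex
  fun_prop

end

/-! ### The phase transition -/

/-- The expected net contribution. -/
noncomputable def meanNet (α β : ℝ) : ℝ :=
  2 * α - 1 + (1 - α) * offspring β (genLim α β 0)

/-- Twice the leading coefficient times the root, plus the linear coefficient, of the quadratic
equation for `1 - genLim`: its sign tells which of the two roots is taken. -/
noncomputable def rootSign (α β s : ℝ) : ℝ :=
  2 * (β * (1 - β)) * (α * s ^ 2 + (1 - α)) * (1 - genLim α β s) -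
    (1 - s) * (1 - α - α * s)

section

variable {α β : ℝ}

theorem var_pos (hβ : 0 < β ∧ β ≤ 1 / 2) : 0 < β * (1 - β) :=
  mul_pos hβ.1 (by linarith [hβ.2])

theorem var_le (β : ℝ) : β * (1 - β) ≤ 1 / 4 := by nlinarith [sq_nonneg (β - 1 / 2)]

theorem alphaC_lt_half (hβ : 0 < β ∧ β ≤ 1 / 2) : alphaC β < 1 / 2 := by
  have hb := var_pos hβ
  have : β * (1 - β) < √(β * (1 - β) * (2 + β * (1 - β))) := by
    apply Real.lt_sqrt_of_sq_lt; nlinarith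
  unfold alphaC; linarith

/-- `alphaC` is the smaller root of (1-2α)² = 4bα; the two roots add up to 1+b. -/
theorem disc_eq (hβ : 0 < β ∧ β ≤ 1 / 2) : (1 - 2 * α) ^ 2 - 4 * (β * (1 - β)) * α =
    4 * (alphaC β - α) * (1 + β * (1 - β) - alphaC β - α) := by
  have hb := var_pos hβ
  have := Real.mul_self_sqrt (show 0 ≤ β * (1 - β) * (2 + β * (1 - β)) by positivity)
  unfold alphaC
  linear_combination this

theorem disc_pos (hβ : 0 < β ∧ β ≤ 1 / 2) (h : α < alphaC β) :
    0 < (1 - 2 * α) ^ 2 - 4 * (β * (1 - β)) * α := by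
  have := alphaC_lt_half hβ
  have := var_pos hβ
  rw [disc_eq hβ]
  exact mul_pos (by linarith) (by linarith)

theorem disc_nonneg (hβ : 0 < β ∧ β ≤ 1 / 2) (h : α ≤ alphaC β) :
    0 ≤ (1 - 2 * α) ^ 2 - 4 * (β * (1 - β)) * α := by
  have := alphaC_lt_half hβ
  have := var_pos hβ
  rw [disc_eq hβ]
  exact mul_nonneg (by linarith) (by linarith)

theorem disc_neg (hβ : 0 < β ∧ β ≤ 1 / 2) (h : alphaC β < α) (h' : α < 1 / 2) :
    (1 - 2 * α) ^ 2 - 4 * (β * (1 - β)) * α < 0 := by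
  have := alphaC_lt_half hβ
  have := var_pos hβ
  rw [disc_eq hβ]
  exact mul_neg_of_neg_of_pos (by linarith) (by linarith)

variable (hα : 0 < α ∧ α < 1) (hβ : 0 < β ∧ β ≤ 1 / 2)

theorem quad_coeff_pos (hα : 0 < α ∧ α < 1) (s : ℝ) : 0 < α * s ^ 2 + (1 - α) := by
  have := hα.1; have : 0 < 1 - α := by linarith [hα.2]
  positivity

include hα hβ

theorem genLim_quadratic {s : ℝ} (hs : 0 ≤ s) (hs' : s ≤ 1) :
    β * (1 - β) * (α * s ^ 2 + (1 - α)) * (1 - genLim α β s) ^ 2 -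
      (1 - s) * (1 - α - α * s) * (1 - genLim α β s) + α * (1 - s) ^ 2 =
    (1 - s) * meanNet α β := by
  have h := genLim_eq hα hβ hs hs'
  rw [offspring_eq β (genLim α β s)] at h
  unfold meanNet
  linear_combination (-1) * h

theorem rootSign_sq {s : ℝ} (hs : 0 ≤ s) (hs' : s ≤ 1) :
    rootSign α β s ^ 2 =
      (1 - s) ^ 2 * ((1 - α - α * s) ^ 2 - 4 * (β * (1 - β)) * α * (α * s ^ 2 + (1 - α))) +
      4 * (β * (1 - β)) * (α * s ^ 2 + (1 - α)) * ((1 - s) * meanNet α β) := by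
  rw [← genLim_quadratic hα hβ hs hs']; unfold rootSign; ring

/-- Were the sign nonpositive, then b(αs²+1-α)(1-G) ≤ (1-s)(1-α-αs), and the quadratic would leave
at most α(1-s)² for (1-s) E Y. -/
theorem rootSign_pos {s : ℝ} (hs : 0 ≤ s) (hs' : s < 1) (h : α * (1 - s) < meanNet α β) :
    0 < rootSign α β s := by
  by_contra! hn
  have hq := genLim_quadratic hα hβ hs hs'.le
  have hg : 0 ≤ 1 - genLim α β s := sub_nonneg.2 (genLim_le_one hα hβ hs hs'.le)
  have hA := quad_coeff_pos hα s
  have hb := var_pos hβ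
  set g := 1 - genLim α β s
  set A := α * s ^ 2 + (1 - α)
  have h1 : β * (1 - β) * A * g ≤ (1 - s) * (1 - α - α * s) := by
    have : 0 ≤ β * (1 - β) * A * g := by positivity
    unfold rootSign at hn; linarith
  have h2 := mul_le_mul_of_nonneg_right h1 hg
  have h3 : (1 - s) * meanNet α β ≤ (1 - s) * (α * (1 - s)) := by
    rw [← hq]; linarith
  exact absurd (le_of_mul_le_mul_left h3 (by linarith)) (not_le.2 h)

theorem continuousOn_rootSign : ContinuousOn (rootSign α β) (Set.Icc 0 1) := by
  have := continuousOn_genLim hα hβ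
  unfold rootSign
  fun_prop

/-- Divide the quadratic by 1-s, discard the square and let s → 1. -/
theorem meanNet_nonneg : 0 ≤ meanNet α β := by
  have hc := (continuousOn_genLim hα hβ) 1 (by simp)
  have h1 : Tendsto (fun s => α * (1 - s) - (1 - α - α * s) * (1 - genLim α β s))
      (𝓝[Set.Ioo 0 1] 1) (𝓝 (α * (1 - 1) - (1 - α - α * 1) * (1 - genLim α β 1))) := by
    have h2 : ContinuousWithinAt (genLim α β) (Set.Ioo 0 1) 1 := hc.mono Set.Ioo_subset_Icc_self
    exact ContinuousWithinAt.tendsto (by fun_prop)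
  rw [genLim_one hα hβ] at h1
  have hne : (𝓝[Set.Ioo (0 : ℝ) 1] 1).NeBot := by
    rw [← mem_closure_iff_nhdsWithin_neBot, closure_Ioo (by norm_num)]; simp
  have := le_of_tendsto h1 (eventually_mem_nhdsWithin.mono fun s hs => ?_ :
    ∀ᶠ s in _, _ ≤ meanNet α β)
  · linarith
  have hq := genLim_quadratic hα hβ hs.1.le hs.2.le
  have hA := quad_coeff_pos hα s
  have hb := var_pos hβ
  have h4 : 0 ≤ β * (1 - β) * (α * s ^ 2 + (1 - α)) * (1 - genLim α β s) ^ 2 := by positivity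
  refine le_of_mul_le_mul_left (?_ : (1 - s) * _ ≤ (1 - s) * _) (by linarith [hs.2])
  rw [← hq]; linarith

/-- With E Y ≤ 0, nonnegativity of `rootSign`² makes the reduced discriminant nonnegative for all s
< 1, hence at s = 1, where it is negative for α between `alphaC` and 1/2. -/
theorem meanNet_pos (h : alphaC β < α) : 0 < meanNet α β := by
  rcases le_or_gt (1 / 2) α with h2 | h2
  · have := mul_pos (sub_pos.2 hα.2)
      (offspring_pos hβ (genLim_nonneg hα hβ le_rfl zero_le_one))
    unfold meanNet; linarith
  by_contra! hy
  have key : ∀ s ∈ Set.Ioo (0 : ℝ) 1,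
      0 ≤ (1 - α - α * s) ^ 2 - 4 * (β * (1 - β)) * α * (α * s ^ 2 + (1 - α)) := by
    intro s hs
    have hq := rootSign_sq hα hβ hs.1.le hs.2.le
    have hA := quad_coeff_pos hα s
    have hb := var_pos hβ
    have h1 : 4 * (β * (1 - β)) * (α * s ^ 2 + (1 - α)) * ((1 - s) * meanNet α β) ≤ 0 :=
      mul_nonpos_of_nonneg_of_nonpos (by positivity)
        (mul_nonpos_of_nonneg_of_nonpos (by linarith [hs.2]) hy)
    have h3 : 0 < (1 - s) ^ 2 := by have := hs.2; have : 0 < 1 - s := by linarith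
                                    positivity
    exact nonneg_of_mul_nonneg_right (by linarith [sq_nonneg (rootSign α β s)]) h3
  have hcl : (1 : ℝ) ∈ closure (Set.Ioo (0 : ℝ) 1) := by rw [closure_Ioo (by norm_num)]; simp
  have h1 := (isClosed_le continuous_const (by fun_prop :
    Continuous fun s : ℝ => (1 - α - α * s) ^ 2 -
      4 * (β * (1 - β)) * α * (α * s ^ 2 + (1 - α)))).closure_subset_iff.2 key hcl
  have h3 := disc_neg hβ h h2
  simp only [Set.mem_ofPred_eq] at h1
  nlinarith

/-- If E Y > 0, then `rootSign` is negative at 0 and positive near 1, so it vanishes in between by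
continuity; but the formula for its square is strictly positive there when the discriminant at 1 is
nonnegative. -/
theorem meanNet_eq_zero (h : α ≤ alphaC β) : meanNet α β = 0 := by
  refine le_antisymm ?_ (meanNet_nonneg hα hβ)
  by_contra! hy
  have hα2 : α < 1 / 2 := h.trans_lt (alphaC_lt_half hβ)
  obtain ⟨s, hs0, hs1, hs⟩ : ∃ s : ℝ, 0 < s ∧ s < 1 ∧ α * (1 - s) < meanNet α β := by
    refine ⟨max (1 / 2) (1 - meanNet α β / 2), by positivity,
      max_lt (by norm_num) (by linarith), ?_⟩
    have h1 := le_max_right (1 / 2) (1 - meanNet α β / 2)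
    have := hα.1
    nlinarith
  have h0 : rootSign α β 0 < 0 := by
    have hb := var_pos hβ
    have := var_le β
    have hG := genLim_nonneg hα hβ le_rfl zero_le_one
    have : 0 ≤ β * (1 - β) * genLim α β 0 := by positivity
    have h1 : 2 * (β * (1 - β)) * (1 - genLim α β 0) - 1 < 0 := by linarith
    have := mul_neg_of_pos_of_neg (sub_pos.2 hα.2) h1
    unfold rootSign; linarith
  have h1 := rootSign_pos hα hβ hs0.le hs1 hs
  obtain ⟨r, hr, hr0⟩ := intermediate_value_Icc hs0.le
    ((continuousOn_rootSign hα hβ).mono (Set.Icc_subset_Icc_right hs1.le)) ⟨h0.le, h1.le⟩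
  have hq := rootSign_sq hα hβ hr.1 (hr.2.trans hs1.le)
  have hr1 : 0 < 1 - r := by linarith [hr.2]
  have hA := quad_coeff_pos hα r
  have hb := var_pos hβ
  have h2 : 0 ≤ (1 - α - α * r) ^ 2 - 4 * (β * (1 - β)) * α * (α * r ^ 2 + (1 - α)) := by
    have h3 := disc_nonneg hβ h
    have hr2 : r ^ 2 ≤ 1 := pow_le_one₀ hr.1 (by linarith)
    have := hα.1
    have h4 : (1 - 2 * α) ^ 2 ≤ (1 - α - α * r) ^ 2 := by
      apply pow_le_pow_left₀ <;> nlinarith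
    have h5 : 0 ≤ 4 * (β * (1 - β)) * α * (α * (1 - r ^ 2)) :=
      mul_nonneg (by positivity) (mul_nonneg hα.1.le (by linarith))
    linarith
  rw [hr0] at hq
  have h6 : 0 < 4 * (β * (1 - β)) * (α * r ^ 2 + (1 - α)) * ((1 - r) * meanNet α β) := by
    positivity
  have h7 := mul_nonneg (sq_nonneg (1 - r)) h2
  linarith

/-- Above the critical point, side trees make the runoff transient along the longest branch. -/
theorem exists_contraction_supercritical (h : alphaC β < α) : ∃ s : ℝ, 0 < s ∧ s < 1 ∧
    (α * s + (1 - α) * s⁻¹) *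
      (1 - 2 * (β * (1 - β)) + 2 * (β * (1 - β)) * genLim α β s) < 1 := by
  have hy := meanNet_pos hα hβ h
  obtain ⟨s, hs0, hs1, hs⟩ : ∃ s : ℝ, 0 < s ∧ s < 1 ∧ α * (1 - s) < meanNet α β := by
    refine ⟨max (1 / 2) (1 - meanNet α β / 2), by positivity,
      max_lt (by norm_num) (by linarith), ?_⟩
    have h1 := le_max_right (1 / 2) (1 - meanNet α β / 2)
    have := hα.1
    have := hα.2
    nlinarith
  refine ⟨s, hs0, hs1, ?_⟩
  have h1 := rootSign_pos hα hβ hs0.le hs1 hs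
  refine lt_of_mul_lt_mul_left ?_ hs0.le
  have h2 : s * (α * s + (1 - α) * s⁻¹) = α * s ^ 2 + (1 - α) := by field_simp
  rw [← mul_assoc, h2]
  -- Since (1-s)(1-α-αs) = (αs²+1-α) - s, positivity of `rootSign` is exactly the contraction
  -- multiplied by s.
  unfold rootSign at h1
  linarith

/-- Below the critical point, the runoff has an exponential moment of small rate for which it is
contracted along the longest branch. -/
theorem exists_contraction_subcritical (h : α < alphaC β) : ∃ s F : ℝ, 1 < s ∧ 1 ≤ F ∧
    (∀ n, gen α β n s ≤ F) ∧
    (α * s + (1 - α) * s⁻¹) * (1 - 2 * (β * (1 - β)) + 2 * (β * (1 - β)) * F) < 1 := by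
  have hb := var_pos hβ
  have hD := disc_pos hβ h
  have hα2 : α < 1 / 2 := h.trans (alphaC_lt_half hβ)
  have hy := meanNet_eq_zero hα hβ h.le
  set b := β * (1 - β) with hb'
  set D := (1 - 2 * α) ^ 2 - 4 * b * α with hD'
  have hα0 := hα.1
  have hD1 : D < 1 - 2 * α := by nlinarith [mul_pos hb hα0]
  -- y(1-2α) - by² - α has maximum D/(4b) at y = (1-2α)/(2b). Stepping slightly left of the
  -- maximizer keeps it positive and makes the first inequality strict.
  obtain ⟨y, hy1, hy2, hy0⟩ : ∃ y : ℝ, 2 * b * y < 1 - 2 * α ∧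
      0 < y * (1 - 2 * α) - b * y ^ 2 - α ∧ 0 ≤ y := by
    have h2 : 2 * b * (((1 - 2 * α) - D / 2) / (2 * b)) = (1 - 2 * α) - D / 2 := by field_simp
    refine ⟨((1 - 2 * α) - D / 2) / (2 * b), by rw [h2]; linarith, ?_,
      div_nonneg (by linarith) (by linarith)⟩
    set y := ((1 - 2 * α) - D / 2) / (2 * b)
    refine (mul_pos_iff_of_pos_left (by linarith : 0 < 4 * b)).1 ?_
    have : 4 * b * (y * (1 - 2 * α) - b * y ^ 2 - α) =
      2 * (1 - 2 * α) * (2 * b * y) - (2 * b * y) ^ 2 - 4 * b * α := by ring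
    rw [this, h2]
    nlinarith
  -- With s = 1+u and F = 1+uy, these are the bound propagating `gen` ≤ F, divided by u², and the
  -- contraction, divided by u.
  have hev : ∀ᶠ u : ℝ in 𝓝[>] 0,
      0 < y * (1 - 2 * α) - b * y ^ 2 - α - u * (2 * α * b * y ^ 2 + α * y + u * (α * b * y ^ 2)) ∧
      0 < 1 - 2 * α - 2 * b * y - u * (α + 4 * α * b * y + u * (2 * α * b * y)) := by
    have c1 : Continuous fun u : ℝ => y * (1 - 2 * α) - b * y ^ 2 - α -
      u * (2 * α * b * y ^ 2 + α * y + u * (α * b * y ^ 2)) := by fun_prop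
    have c2 : Continuous fun u : ℝ => 1 - 2 * α - 2 * b * y -
      u * (α + 4 * α * b * y + u * (2 * α * b * y)) := by fun_prop
    refine nhdsWithin_le_nhds (Eventually.and ?_ ?_)
    · exact c1.continuousAt.eventually (lt_mem_nhds (by simpa using hy2))
    · exact c2.continuousAt.eventually (lt_mem_nhds (by simp only [zero_mul]; linarith))
  obtain ⟨u, ⟨hu1, hu2⟩, hu⟩ := (hev.and self_mem_nhdsWithin).exists
  have hu : 0 < u := hu
  refine ⟨1 + u, 1 + u * y, by linarith, by nlinarith, fun n => ?_, ?_⟩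
  · induction n with
    | zero => rw [gen_zero]; positivity
    | succ n ih =>
      refine le_of_mul_le_mul_left ?_ (by linarith : 0 < 1 + u)
      rw [gen_succ]
      have hA := quad_coeff_pos hα (1 + u)
      have h1 := mul_le_mul_of_nonneg_left
        (offspring_mono hβ (gen_nonneg hα hβ n (by linarith)) ih) hA.le
      have h2 := mul_le_mul_of_nonneg_left
        (offspring_mono hβ (gen_nonneg hα hβ n le_rfl) (gen_le_genLim hα hβ n le_rfl zero_le_one))
        (mul_nonneg (sub_nonneg.2 hα.2.le) hu.le)
      -- This is E Y = 0; it cancels the terms of first order in u.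
      have h3 : (1 - α) * offspring β (genLim α β 0) = 1 - 2 * α := by
        unfold meanNet at hy; linarith
      have h4 : (1 - α) * u * offspring β (genLim α β 0) = u * (1 - 2 * α) := by rw [← h3]; ring
      rw [offspring_eq β (1 + u * y), ← hb'] at h1
      have h5 := mul_pos (pow_pos hu 2) hu1
      nlinarith
  · refine lt_of_mul_lt_mul_left ?_ (by linarith : (0 : ℝ) ≤ 1 + u)
    have h4 : (1 + u) * (α * (1 + u) + (1 - α) * (1 + u)⁻¹) = α * (1 + u) ^ 2 + (1 - α) := by
      field_simp
    rw [← mul_assoc, h4]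
    have h5 := mul_pos hu hu2
    nlinarith

end

/-! ### Trees conditioned on their height -/

/-- An almost contracting affine recursion stays below any asymptotically constant sequence. -/
theorem exists_le_mul_of_recursion {a e c : ℕ → ℝ} {θ K : ℝ} (he : ∀ n, 0 < e n)
    (hc : Tendsto c atTop (𝓝 1)) (hec : ∀ n, e (n + 1) = c n * e n) (ha : ∀ n, 0 ≤ a n)
    (hθ0 : 0 ≤ θ) (hθ : θ < 1) (hK : 0 ≤ K) (hrec : ∀ n, a (n + 1) ≤ θ * a n + K * e n) :
    ∃ C, 0 ≤ C ∧ ∀ n, a n ≤ C * e n := by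
  obtain ⟨θ', h1, h2⟩ := exists_between hθ
  have hev : ∀ᶠ n in atTop, θ < θ' * c n ∧ 1 / 2 < c n :=
    ((hc.const_mul θ').eventually (lt_mem_nhds (by simpa using h1))).and
      (hc.eventually (lt_mem_nhds (by norm_num)))
  obtain ⟨N, hN⟩ := eventually_atTop.1 hev
  have hq : ∀ n, 0 ≤ a n / e n := fun n => div_nonneg (ha n) (he n).le
  have hK' : 0 ≤ 2 * K / (1 - θ') := div_nonneg (by linarith) (by linarith)
  -- The sum covers the indices up to N. Beyond N, c n > 1/2 and 2K ≤ (1-θ')C give K ≤ (1-θ') c n C,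
  -- which absorbs the inhomogeneous term.
  set C := ∑ k ∈ Finset.range (N + 1), a k / e k + 2 * K / (1 - θ') with hC
  have hC0 : 0 ≤ C := add_nonneg (Finset.sum_nonneg fun k _ => hq k) hK'
  refine ⟨C, hC0, fun n => ?_⟩
  rcases le_or_gt n N with hn | hn
  · rw [← div_le_iff₀ (he n)]
    exact (Finset.single_le_sum (f := fun k => a k / e k) (fun k _ => hq k)
      (Finset.mem_range_succ_iff.2 hn)).trans (le_add_of_nonneg_right hK')
  induction n, hn.le using Nat.le_induction with
  | base => exact absurd hn (lt_irrefl _)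
  | succ n hNn ih =>
    have ih' : a n ≤ C * e n := by
      rcases hNn.eq_or_lt with h | h
      · rw [← div_le_iff₀ (he n)]
        exact (Finset.single_le_sum (f := fun k => a k / e k) (fun k _ => hq k)
          (Finset.mem_range_succ_iff.2 h.ge)).trans (le_add_of_nonneg_right hK')
      · exact ih h
    obtain ⟨h3, h4⟩ := hN n hNn
    have h5 : 2 * K ≤ (1 - θ') * C := by
      have : 2 * K / (1 - θ') ≤ C :=
        le_add_of_nonneg_left (Finset.sum_nonneg fun k _ => hq k)
      rw [div_le_iff₀ (by linarith)] at this
      linarith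
    have h6 : θ * C + K ≤ c n * C := by
      have := mul_le_mul_of_nonneg_right h3.le hC0
      nlinarith
    calc a (n + 1) ≤ θ * a n + K * e n := hrec n
      _ ≤ θ * (C * e n) + K * e n := by gcongr
      _ = (θ * C + K) * e n := by ring
      _ ≤ (c n * C) * e n := mul_le_mul_of_nonneg_right h6 (he n).le
      _ = C * e (n + 1) := by rw [hec]; ring

/-- The factor of a point contribution in the exponential weight of the runoff. -/
noncomputable def pointFactor (s : ℝ) (x : Bool) : ℝ := if x then s else s⁻¹

/-- Positive runoff means that the truncation at 0 is inactive, so the weight factorizes exactly. -/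
theorem pow_flow_node {s : ℝ} (hs : 0 < s) (x : Bool) (l r : BinaryTree Bool)
    (h : 0 < flow (.node x l r)) :
    s ^ flow (.node x l r) = pointFactor s x * (s ^ flow l * s ^ flow r) := by
  cases x
  · simp only [flow, pointFactor, Bool.false_eq_true, if_false] at h ⊢
    rw [← pow_add, eq_inv_mul_iff_mul_eq₀ hs.ne', ← pow_succ', Nat.sub_add_cancel (by omega)]
  · simp [flow, pointFactor]; ring

theorem pointFactor_pos {s : ℝ} (hs : 0 < s) (x : Bool) : 0 < pointFactor s x := by
  unfold pointFactor; split <;> positivity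

theorem one_le_of_flow_node_eq_zero {s : ℝ} (hs : 0 < s) (hs' : s ≤ 1) (x : Bool)
    (l r : BinaryTree Bool) (h : flow (.node x l r) = 0) :
    1 ≤ pointFactor s x * (s ^ flow l * s ^ flow r) := by
  cases x
  · simp only [flow, pointFactor, Bool.false_eq_true, if_false] at h ⊢
    rw [← pow_add, le_inv_mul_iff₀ hs, mul_one]
    calc s = s ^ 1 := (pow_one s).symm
      _ ≤ s ^ (flow l + flow r) := pow_le_pow_of_le_one hs.le hs' (by omega)
  · simp [flow] at h

/-! ### Ratios of height probabilities, and the subcritical bound on the contributing cluster -/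

section

variable {α β : ℝ}

/-- The ratio of the probabilities of consecutive heights. -/
noncomputable def heightRatio (α β : ℝ) (n : ℕ) : ℝ :=
  1 - 2 * (β * (1 - β)) + β * (1 - β) * (gen α β (n + 1) 1 + gen α β n 1)

theorem ex_nodeProd_pow (n : ℕ) (s r : ℝ) :
    ex α β (n + 1) (nodeProd (pointFactor r) (fun t => s ^ flow t) fun t => s ^ flow t) =
      (α * r + (1 - α) * r⁻¹) * offspring β (gen α β n s) := by
  rw [ex_succ_nodeProd]; simp [pointFactor, offspring, gen, flow]

variable (hα : 0 < α ∧ α < 1) (hβ : 0 < β ∧ β ≤ 1 / 2)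
include hα hβ

theorem tendsto_heightRatio : Tendsto (heightRatio α β) atTop (𝓝 1) := by
  have h := tendsto_gen_one hα hβ
  have h2 := (((h.comp (tendsto_add_atTop_nat 1)).add h).const_mul (β * (1 - β))).const_add
    (1 - 2 * (β * (1 - β)))
  rw [show 1 - 2 * (β * (1 - β)) + β * (1 - β) * (1 + 1) = (1 : ℝ) by ring] at h2
  exact h2

theorem heightRatio_pos (n : ℕ) : 0 < heightRatio α β n := by
  have h1 := gen_nonneg hα hβ n zero_le_one
  have h2 := gen_nonneg hα hβ (n + 1) zero_le_one
  have hb := var_pos hβ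
  have := var_le β
  have := mul_nonneg hb.le (add_nonneg h2 h1)
  unfold heightRatio; linarith

theorem heightRatio_le_one (n : ℕ) : heightRatio α β n ≤ 1 := by
  have h1 := gen_one_le hα hβ n
  have h2 := gen_one_le hα hβ (n + 1)
  have := mul_le_mul_of_nonneg_left (add_le_add h2 h1) (var_pos hβ).le
  unfold heightRatio; linarith

theorem level_one_pos (n : ℕ) : 0 < exLevel α β n fun _ => 1 := by
  induction n with
  | zero =>
    have h : exLevel α β 0 (fun _ => 1) = gen α β 1 1 - gen α β 0 1 := by
      simp [exLevel_eq_sub, gen]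
    rw [h, gen_one_succ, gen_zero, sub_zero]
    exact offspring_pos hβ le_rfl
  | succ n ih => rw [level_one_succ]; exact mul_pos (heightRatio_pos hα hβ n) ih

theorem level_one_succ_le (n : ℕ) :
    exLevel α β (n + 1) (fun _ => 1) ≤ exLevel α β n fun _ => 1 := by
  rw [level_one_succ]
  exact mul_le_of_le_one_left (level_one_pos hα hβ n).le (heightRatio_le_one hα hβ n)

omit hβ in
theorem pointMean_pos {s : ℝ} (hs : 0 < s) : 0 < α * s + (1 - α) * s⁻¹ := by
  have := hα.1; have : 0 < 1 - α := by linarith [hα.2]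
  positivity

/-- In the subcritical case the size of the contributing cluster is bounded in mean, uniformly in
the height of the tree. -/
theorem exists_cluster_le (h : α < alphaC β) :
    ∃ C, 0 ≤ C ∧ ∀ n, exLevel α β n (fun t => (cluster t : ℝ)) ≤ C * exLevel α β n fun _ => 1 := by
  obtain ⟨s, M, hs1, hM, hgen, hθ⟩ := exists_contraction_subcritical hα hβ h
  have hs : 0 < s := by linarith
  have hσ := pointMean_pos hα hs
  have hb := var_pos hβ
  have hb4 := var_le β
  set σ := α * s + (1 - α) * s⁻¹
  set θ := σ * (1 - 2 * (β * (1 - β)) + 2 * (β * (1 - β)) * M) with hθ'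
  have hθ0 : 0 ≤ θ := mul_nonneg hσ.le (by nlinarith)
  set F := fun n => gen α β n s
  -- Cluster size, unlike height, is additive over subtrees, so its recursion is linear. The factor
  -- s^flow makes it contract: where the runoff vanishes the cluster is empty and the truncation
  -- does no harm.
  set ψ : BinaryTree Bool → ℝ := fun t => cluster t * s ^ flow t
  set L := fun n => ex α β n ψ
  have hF0 : ∀ n, 0 ≤ F n := fun n => gen_nonneg hα hβ n hs.le
  have hψ0 : ∀ t, 0 ≤ ψ t := fun t => by positivity
  have hL0 : ∀ n, 0 ≤ L n := fun n => ex_nonneg hα hβ n hψ0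
  have hdF : ∀ n, F (n + 1) = F n + exLevel α β n fun t => s ^ flow t :=
    fun n => ex_succ_eq_add n _
  have hdL : ∀ n, L (n + 1) = L n + exLevel α β n ψ := fun n => ex_succ_eq_add n _
  have hd := level_one_pos hα hβ
  have hX0 : ∀ n, 0 ≤ exLevel α β n fun t => s ^ flow t :=
    fun n => exLevel_nonneg hα hβ n fun _ => by positivity
  have hY0 : ∀ n, 0 ≤ exLevel α β n ψ := fun n => exLevel_nonneg hα hβ n hψ0
  set P := nodeProd (pointFactor s) (fun t => s ^ flow t) fun t => s ^ flow t
  set Q : BinaryTree Bool → ℝ := fun t => P t +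
    (nodeProd (pointFactor s) ψ (fun t => s ^ flow t) t +
      nodeProd (pointFactor s) (fun t => s ^ flow t) ψ t)
  have hP : ∀ n, ex α β (n + 1) P = σ * offspring β (F n) := fun n => ex_nodeProd_pow n s s
  have hQ : ∀ n, ex α β (n + 1) Q =
      σ * (offspring β (F n) + (1 - 2 * (β * (1 - β)) + 2 * (β * (1 - β)) * F n) * L n) := by
    intro n
    rw [ex_add, hP, ex_add, ex_succ_nodeProd, ex_succ_nodeProd]
    simp only [pointFactor, if_true, Bool.false_eq_true, if_false, flow, pow_zero, ψ, cluster,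
      Nat.cast_zero, zero_mul]
    change _ + (σ * ((_ + (1 - β) * L n) * (_ + β * F n)) +
      σ * ((_ + (1 - β) * F n) * (_ + β * L n))) = _
    ring
  have hψQ : ∀ x l r, ψ (.node x l r) ≤ Q (.node x l r) := by
    intro x l r
    have hp := pointFactor_pos hs x
    simp only [ψ, Q, P, nodeProd, cluster]
    split_ifs with h0
    · rw [Nat.cast_zero, zero_mul]; positivity
    · rw [pow_flow_node hs x l r (Nat.pos_of_ne_zero h0)]
      push_cast; apply le_of_eq; ring
  have hpow : ∀ x l r, s ^ flow (.node x l r) ≤ P (.node x l r) + 1 := by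
    intro x l r
    have hp := pointFactor_pos hs x
    simp only [P, nodeProd]
    rcases Nat.eq_zero_or_pos (flow (.node x l r)) with h0 | h0
    · rw [h0, pow_zero]; exact le_add_of_nonneg_left (by positivity)
    · rw [pow_flow_node hs x l r h0]; linarith
  have hcoef : ∀ n, σ * (1 - 2 * (β * (1 - β)) + 2 * (β * (1 - β)) * F n) ≤ θ := fun n =>
    mul_le_mul_of_nonneg_left (by nlinarith [hgen n]) hσ.le
  obtain ⟨B, hB0, hB⟩ : ∃ B, 0 ≤ B ∧ ∀ n, L n ≤ B * 1 := by
    refine exists_le_mul_of_recursion (e := fun _ => 1) (c := fun _ => 1) (θ := θ)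
      (K := σ * offspring β M) (fun _ => one_pos) tendsto_const_nhds (fun _ => (one_mul 1).symm) hL0
      hθ0 hθ (mul_nonneg hσ.le (offspring_pos hβ (by linarith)).le) fun n => ?_
    have h1 := mul_le_mul_of_nonneg_left (offspring_mono hβ (hF0 n) (hgen n)) hσ.le
    have h2 := mul_le_mul_of_nonneg_right (hcoef n) (hL0 n)
    have h3 : L (n + 1) ≤ ex α β (n + 1) Q := ex_mono_node hα hβ _ hψQ
    rw [hQ] at h3
    linarith
  -- Differencing the recursion for P in n turns `offspring` into the average of the factors at n
  -- and n+1, both at most θ. The extra 1 accounts for zero runoff, where s^flow = 1.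
  obtain ⟨D, hD0, hD⟩ : ∃ D, 0 ≤ D ∧ ∀ n, exLevel α β n (fun t => s ^ flow t) ≤
      D * exLevel α β n fun _ => 1 := by
    refine exists_le_mul_of_recursion (θ := θ) (K := 1) hd (tendsto_heightRatio hα hβ)
      level_one_succ hX0 hθ0 hθ zero_le_one fun n => ?_
    have h1 : exLevel α β (n + 1) (fun t => s ^ flow t) ≤ exLevel α β (n + 1) (fun t => P t + 1) :=
      exLevel_mono_node hα hβ _ hpow
    rw [exLevel_add, exLevel_eq_sub (n + 1) P, hP, hP, offspring_eq, offspring_eq, hdF n] at h1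
    have h2 := mul_le_mul_of_nonneg_right (hcoef n) (hX0 n)
    have h2' := mul_le_mul_of_nonneg_right (hcoef (n + 1)) (hX0 n)
    rw [hdF n] at h2'
    have h3 := level_one_succ_le hα hβ n
    linarith
  -- Differencing the recursion for Q gives the contracted term plus increments of `gen` multiplied
  -- by the bounded L; the bound D makes the latter proportional to the probability of the height.
  obtain ⟨C, hC0, hC⟩ : ∃ C, 0 ≤ C ∧ ∀ n, exLevel α β n ψ ≤ C * exLevel α β n fun _ => 1 := by
    refine exists_le_mul_of_recursion (θ := θ) (K := (θ + σ * (2 * (β * (1 - β)) * B)) * D) hd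
      (tendsto_heightRatio hα hβ) level_one_succ hY0 hθ0 hθ (by positivity) fun n => ?_
    have h1 : exLevel α β (n + 1) ψ ≤ exLevel α β (n + 1) Q :=
      exLevel_mono_node hα hβ _ hψQ
    rw [exLevel_eq_sub (n + 1) Q, hQ, hQ, offspring_eq, offspring_eq, hdL n] at h1
    have h2 := mul_le_mul_of_nonneg_right (hcoef n) (hX0 n)
    have h2' := mul_le_mul_of_nonneg_right (hcoef (n + 1)) (hX0 n)
    have h3 := mul_le_mul_of_nonneg_right (hcoef (n + 1)) (hY0 n)
    have h4 := mul_le_mul_of_nonneg_left (hB n)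
      (show 0 ≤ σ * (2 * (β * (1 - β))) * exLevel α β n (fun t => s ^ flow t) from
        mul_nonneg (by positivity) (hX0 n))
    have h5 := mul_le_mul_of_nonneg_left (hD n)
      (show 0 ≤ θ + σ * (2 * (β * (1 - β)) * B) by positivity)
    rw [hdF n] at h1 h2' h3
    linarith
  refine ⟨C, hC0, fun n => le_trans (exLevel_mono hα hβ n fun t => ?_) (hC n)⟩
  exact le_mul_of_one_le_right (Nat.cast_nonneg _) (one_le_pow₀ hs1.le)

end

/-! ### Supercritical case: tracking the runoff along a longest branch -/

section

variable {α β : ℝ}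

open Classical in
/-- The weight of a tree along which contribution to generation `j` is tracked: the exponential
weight of the runoff, frozen at `1` once the contribution has failed. -/
noncomputable def tracked (s : ℝ) (j : ℕ) (t : BinaryTree Bool) : ℝ :=
  if Reaches j t then s ^ flow t else 1

open Classical in
/-- The indicator of contribution from generation `j`. -/
noncomputable def reachInd (j : ℕ) (t : BinaryTree Bool) : ℝ := if Reaches j t then 1 else 0

theorem reachInd_nonneg (j : ℕ) (t : BinaryTree Bool) : 0 ≤ reachInd j t := by
  unfold reachInd; split_ifs <;> norm_num

/-- Tracking follows the left subtree. After failure there the weight is at most 1. Otherwise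
positive runoff multiplies exactly, and if the runoff dies now the frozen value 1 is below the
product by `one_le_of_flow_node_eq_zero`. -/
theorem tracked_node_le_left {s : ℝ} (hs : 0 < s) (hs' : s ≤ 1) (j : ℕ) (x : Bool)
    (l r : BinaryTree Bool) : tracked s (j + 1) (.node x l r) ≤
      1 * ((1 - reachInd j l) * 1) +
        pointFactor s x * ((reachInd j l * s ^ flow l) * s ^ flow r) := by
  have hp := pointFactor_pos hs x
  by_cases hl : Reaches j l
  · simp only [reachInd, hl, if_true, sub_self, zero_mul, mul_zero, zero_add, one_mul]
    rcases Nat.eq_zero_or_pos (flow (.node x l r)) with h0 | h0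
    · have : ¬ Reaches (j + 1) (.node x l r) := fun h => by simp [Reaches, h0] at h
      rw [tracked, if_neg this]
      exact one_le_of_flow_node_eq_zero hs hs' x l r h0
    · have : Reaches (j + 1) (.node x l r) := ⟨h0, Or.inl hl⟩
      rw [tracked, if_pos this, pow_flow_node hs x l r h0]
  · simp only [reachInd, hl, if_false, sub_zero, zero_mul, mul_zero, add_zero, one_mul]
    unfold tracked
    split_ifs
    · exact pow_le_one₀ hs.le hs'
    · exact le_rfl

theorem tracked_node_le_right {s : ℝ} (hs : 0 < s) (hs' : s ≤ 1) (j : ℕ) (x : Bool)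
    (l r : BinaryTree Bool) : tracked s (j + 1) (.node x l r) ≤
      1 * (1 * (1 - reachInd j r)) +
        pointFactor s x * (s ^ flow l * (reachInd j r * s ^ flow r)) := by
  have h := tracked_node_le_left hs hs' j x r l
  have h1 : flow (.node x r l) = flow (.node x l r) := by simp only [flow, Nat.add_comm]
  have h2 : tracked s (j + 1) (.node x r l) = tracked s (j + 1) (.node x l r) := by
    have hR : Reaches (j + 1) (.node x r l) ↔ Reaches (j + 1) (.node x l r) := by
      rw [Reaches, Reaches, h1, or_comm]
    rw [tracked, tracked, h1]
    split_ifs with a b b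
    · rfl
    · exact absurd (hR.1 a) b
    · exact absurd (hR.2 b) a
    · rfl
  rw [h2] at h
  linarith

theorem tracked_eq (s : ℝ) (j : ℕ) (t : BinaryTree Bool) :
    tracked s j t = (1 - reachInd j t) + reachInd j t * s ^ flow t := by
  unfold tracked reachInd; split_ifs <;> simp

variable (hα : 0 < α ∧ α < 1) (hβ : 0 < β ∧ β ≤ 1 / 2)
include hα hβ

theorem sum_le_of_node_le (S T : Finset (BinaryTree Bool)) {φ u v u' v' : BinaryTree Bool → ℝ}
    {h h' : Bool → ℝ}
    (hφ : ∀ x l r, φ (.node x l r) ≤ h x * (u l * v r) + h' x * (u' l * v' r)) :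
    ∑ x, ∑ l ∈ S, ∑ r ∈ T, pointWeight α x *
      (edgeWeight (1 - β) (weight α β l) l * edgeWeight β (weight α β r) r) *
        φ (.node x l r) ≤
    (α * h true + (1 - α) * h false) *
      ((∑ l ∈ S, edgeWeight (1 - β) (weight α β l) l * u l) *
        ∑ r ∈ T, edgeWeight β (weight α β r) r * v r) +
    (α * h' true + (1 - α) * h' false) *
      ((∑ l ∈ S, edgeWeight (1 - β) (weight α β l) l * u' l) *
        ∑ r ∈ T, edgeWeight β (weight α β r) r * v' r) := by
  rw [← sum_product_weights, ← sum_product_weights]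
  simp only [← Finset.sum_add_distrib]
  refine Finset.sum_le_sum fun x _ => Finset.sum_le_sum fun l _ => Finset.sum_le_sum fun r _ => ?_
  rw [← mul_add]
  exact mul_le_mul_of_nonneg_left (hφ x l r) (mul_nonneg (pointWeight_nonneg hα x)
    (mul_nonneg (edgeWeight_nonneg (by linarith) (by linarith) (weight_nonneg hα hβ l) l)
        (edgeWeight_nonneg (by linarith) (by linarith) (weight_nonneg hα hβ r) r)))

/-- Relative to the probability of the height, the tracked weight does not increase: the failed part
is multiplied by exactly `heightRatio`, the surviving part by a factor that is at most this once n
is large. -/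
theorem exLevel_succ_tracked_le {s : ℝ} (hs : 0 < s) (hs' : s ≤ 1) (n j : ℕ)
    (hn : (α * s + (1 - α) * s⁻¹) *
      (1 - 2 * (β * (1 - β)) + 2 * (β * (1 - β)) * genLim α β s) ≤ heightRatio α β n) :
    exLevel α β (n + 1) (tracked s (j + 1)) ≤
      heightRatio α β n * exLevel α β n (tracked s j) := by
  have e1 := sum_le_of_node_le hα hβ (level n) (trees (n + 1)) (tracked_node_le_left hs hs' j)
  have e2 := sum_le_of_node_le hα hβ (trees n) (level n) (tracked_node_le_right hs hs' j)
  simp only [sum_edgeWeight_level, sum_edgeWeight_trees] at e1 e2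
  rw [exLevel_succ, Finset.sum_add_distrib]
  refine (add_le_add e1 e2).trans ?_
  have h3 : exLevel α β n (tracked s j) = exLevel α β n (fun t => 1 - reachInd j t) +
      exLevel α β n (fun t => reachInd j t * s ^ flow t) := by
    rw [← exLevel_add]; exact congrArg _ (funext fun t => tracked_eq s j t)
  have h4 : 0 ≤ exLevel α β n (fun t => reachInd j t * s ^ flow t) :=
    exLevel_nonneg hα hβ n fun t => mul_nonneg (reachInd_nonneg j t) (by positivity)
  rw [h3]
  set w := exLevel α β n (fun t => reachInd j t * s ^ flow t)
  set c := exLevel α β n (fun t => 1 - reachInd j t)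
  have g1 : ∀ m, ex α β m (fun _ => 1) = gen α β m 1 := fun m => by simp [gen]
  have g2 : ∀ m, ex α β m (fun t => s ^ flow t) = gen α β m s := fun m => rfl
  have f0 : Reaches j .nil ↔ False := by cases j <;> simp [Reaches, flow]
  simp only [g1, g2, pointFactor, if_true, Bool.false_eq_true, if_false, flow, pow_zero]
  have hb := var_pos hβ
  have h5 : (α * s + (1 - α) * s⁻¹) * (1 - 2 * (β * (1 - β)) +
      β * (1 - β) * (gen α β (n + 1) s + gen α β n s)) ≤ heightRatio α β n := by
    refine le_trans (mul_le_mul_of_nonneg_left ?_ (pointMean_pos hα hs).le) hn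
    nlinarith [gen_le_genLim hα hβ n hs.le hs', gen_le_genLim hα hβ (n + 1) hs.le hs']
  have h6 := mul_le_mul_of_nonneg_right h5 h4
  refine le_trans (le_of_eq ?_) (add_le_add (le_refl (heightRatio α β n * c)) h6) |>.trans
    (le_of_eq (by ring))
  unfold heightRatio
  ring

/-- A root contribution of 1 forces positive runoff and hence weight at most s; this alone gains
α(1-s). -/
theorem exLevel_tracked_zero_le {s : ℝ} (hs : 0 < s) (hs' : s ≤ 1) (n : ℕ) :
    exLevel α β n (tracked s 0) ≤ (1 - α * (1 - s)) * exLevel α β n fun _ => 1 := by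
  set R := nodeProd (fun x => if x then s else 1) (fun _ => 1) (fun _ => 1)
  have h1 : ∀ m, ex α β m R = (1 - α * (1 - s)) * ex α β m fun _ => 1 := by
    intro m
    cases m with
    | zero => simp [ex_zero]
    | succ m =>
      have h : ex α β (m + 1) (fun _ => 1) = gen α β (m + 1) 1 := by simp [gen]
      rw [h, gen_one_succ, ex_succ_nodeProd]
      have h : ex α β m (fun _ => 1) = gen α β m 1 := by simp [gen]
      simp only [h, if_true, Bool.false_eq_true, if_false, offspring]
      ring
  have h2 : exLevel α β n (tracked s 0) ≤ exLevel α β n R := by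
    refine exLevel_mono_node hα hβ n fun x l r => ?_
    simp only [R, nodeProd, mul_one]
    unfold tracked
    cases x
    · simp only [Bool.false_eq_true, if_false]
      split_ifs
      · exact pow_le_one₀ hs.le hs'
      · exact le_rfl
    · have : Reaches 0 (.node true l r) := by simp [Reaches, flow]
      rw [if_pos this, if_pos rfl]
      exact pow_le_of_le_one hs.le hs' (by simp [flow])
  rw [exLevel_eq_sub n R, h1, h1] at h2
  rw [exLevel_eq_sub n fun _ => 1]
  linarith

/-- In the supercritical case, contribution from far up is uniformly likely. -/
theorem exists_reach_of_large (h : alphaC β < α) : ∃ (m : ℕ) (c : ℝ), 0 < c ∧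
    ∀ j, c * exLevel α β (m + j) (fun _ => 1) ≤ exLevel α β (m + j) (reachInd j) := by
  obtain ⟨s, hs, hs1, hθ⟩ := exists_contraction_supercritical hα hβ h
  obtain ⟨m, hm⟩ := eventually_atTop.1
    ((tendsto_heightRatio hα hβ).eventually (lt_mem_nhds hθ))
  -- The initial gain survives every step down from a subtree of height m. Since `tracked` +
  -- `reachInd` ≥ 1, it bounds the probability of reaching.
  refine ⟨m, α * (1 - s), mul_pos hα.1 (by linarith), fun j => ?_⟩
  have key : exLevel α β (m + j) (tracked s j) ≤
      (1 - α * (1 - s)) * exLevel α β (m + j) fun _ => 1 := by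
    induction j with
    | zero => exact exLevel_tracked_zero_le hα hβ hs hs1.le m
    | succ j ih =>
      refine (exLevel_succ_tracked_le hα hβ hs hs1.le (m + j) j
        (hm _ (Nat.le_add_right m j)).le).trans ?_
      have := mul_le_mul_of_nonneg_left ih (heightRatio_pos hα hβ (m + j)).le
      have e := level_one_succ (α := α) (β := β) (m + j)
      rw [← heightRatio] at e
      rw [← add_assoc, e]
      linarith
  have h1 : exLevel α β (m + j) (fun _ => 1) ≤
      exLevel α β (m + j) (fun t => tracked s j t + reachInd j t) := by
    refine exLevel_mono hα hβ _ fun t => ?_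
    unfold tracked reachInd
    split_ifs
    · exact le_add_of_nonneg_left (by positivity)
    · simp
  rw [exLevel_add] at h1
  linarith

/-- One tree suffices: the all-left path of n+1 nodes, each contributing 1. -/
theorem exLevel_reach_pos (n : ℕ) : 0 < exLevel α β n (reachInd n) := by
  obtain ⟨t, ht, hw, hr⟩ : ∃ t ∈ level n, 0 < weight α β t ∧ Reaches n t := by
    have h1 : 0 < 1 - β := by linarith [hβ.2]
    have h2 := hβ.1
    have h3 := hα.1
    induction n with
    | zero =>
      refine ⟨.node true .nil .nil, mem_level.2 (by simp), ?_, by simp [Reaches, flow]⟩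
      simp only [weight, pointWeight, edgeWeight, if_true, mul_zero, add_zero]
      have : 0 < 1 - (1 - β) := by linarith
      positivity
    | succ n ih =>
      obtain ⟨t, ht, hw, hr⟩ := ih
      refine ⟨.node true t .nil, mem_level.2 ?_, ?_, by simp [Reaches, flow, hr]⟩
      · rw [BinaryTree.height, mem_level.1 ht]; simp
      · have : t ≠ .nil := by rintro rfl; simpa using mem_level.1 ht
        simp only [weight, pointWeight, edgeWeight, if_true, this, if_false, mul_zero, add_zero,
          zero_add]
        positivity
  refine Finset.sum_pos' (fun t _ => mul_nonneg (weight_nonneg hα hβ t) (reachInd_nonneg n t))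
    ⟨t, ht, ?_⟩
  rw [reachInd, if_pos hr, mul_one]; exact hw

theorem exists_reach_of_lt (N : ℕ) : ∃ c : ℝ, 0 < c ∧
    ∀ n < N, c * exLevel α β n (fun _ => 1) ≤ exLevel α β n (reachInd n) := by
  induction N with
  | zero => exact ⟨1, one_pos, fun n hn => absurd hn (Nat.not_lt_zero n)⟩
  | succ N ih =>
    obtain ⟨c, hc, h⟩ := ih
    have hd := level_one_pos hα hβ
    have hr := exLevel_reach_pos hα hβ N
    refine ⟨min c (exLevel α β N (reachInd N) / exLevel α β N fun _ => 1),
      lt_min hc (div_pos hr (hd N)), fun n hn => ?_⟩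
    rcases Nat.lt_succ_iff_lt_or_eq.1 hn with hn | rfl
    · exact (mul_le_mul_of_nonneg_right (min_le_left _ _) (hd n).le).trans (h n hn)
    · refine (mul_le_mul_of_nonneg_right (min_le_right _ _) (hd n).le).trans ?_
      rw [div_mul_cancel₀ _ (hd n).ne']

/-- In the supercritical case, the bottom part of the tree contributes with a probability that is
bounded below uniformly in the height. -/
theorem exists_reach (h : alphaC β < α) {δ : ℝ} (hδ : 0 < δ) : ∃ c : ℝ, 0 < c ∧
    ∀ n : ℕ, ∃ j : ℕ, (1 - δ) * n ≤ j ∧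
      c * exLevel α β n (fun _ => 1) ≤ exLevel α β n (reachInd j) := by
  obtain ⟨m, c, hc, hm⟩ := exists_reach_of_large hα hβ h
  -- For n ≥ m/δ, the generation j = n-m satisfies (1-δ)n ≤ j; the finitely many smaller n use j =
  -- n.
  obtain ⟨N, hN⟩ := exists_nat_ge (m / δ)
  obtain ⟨c', hc', hN'⟩ := exists_reach_of_lt hα hβ (max N m)
  refine ⟨min c c', lt_min hc hc', fun n => ?_⟩
  have hd := (level_one_pos hα hβ n).le
  rcases lt_or_ge n (max N m) with hn | hn
  · refine ⟨n, ?_, (mul_le_mul_of_nonneg_right (min_le_right _ _) hd).trans (hN' n hn)⟩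
    have : 0 ≤ δ * n := by positivity
    linarith
  · obtain ⟨j, rfl⟩ := Nat.exists_eq_add_of_le ((le_max_right N m).trans hn)
    refine ⟨j, ?_, (mul_le_mul_of_nonneg_right (min_le_left _ _) hd).trans (hm j)⟩
    have h1 : (N : ℝ) ≤ ((m + j : ℕ) : ℝ) := by exact_mod_cast (le_max_left N m).trans hn
    have h2 := (div_le_iff₀ hδ).1 (hN.trans h1)
    push_cast at h2 ⊢
    linarith

end

/-! ### Realizations of finite trees -/

/-- The drainage tree of the cell `v`, with its point contributions, is the given finite tree. -/
def Realizes (x : List Bool → ℝ) (c : List Bool → Bool → ℝ) : BinaryTree Bool → List Bool → Prop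
  | .nil, _ => False
  | .node a l r, v => x v = (if a then 1 else -1) ∧
      ((l = .nil ∧ c v false = 0) ∨ (c v false = 1 ∧ Realizes x c l (false :: v))) ∧
      ((r = .nil ∧ c v true = 0) ∨ (c v true = 1 ∧ Realizes x c r (true :: v)))

/-- The path `p`, followed upwards from `v`, consists of draining edges between cells satisfying
`A`. -/
def UpPath (A : List Bool → Prop) (c : List Bool → Bool → ℝ) : List Bool → List Bool → Prop
  | v, [] => A v
  | v, b :: p => A v ∧ c v b = 1 ∧ UpPath A c (b :: v) p

/-- The net contribution at the root of a finite tree. -/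
noncomputable def net : BinaryTree Bool → ℝ
  | .nil => 0
  | .node x l r => flow (.node x l r) - (flow l + flow r)

section

variable {x : List Bool → ℝ} {c : List Bool → Bool → ℝ}

theorem Realizes.unique {t t' : BinaryTree Bool} {v : List Bool} (h : Realizes x c t v)
    (h' : Realizes x c t' v) : t = t' := by
  induction t generalizing t' v with
  | nil => exact h.elim
  | node a l r hl hr =>
    cases t' with
    | nil => exact h'.elim
    | node a' l' r' =>
      obtain ⟨h1, h2, h3⟩ := h
      obtain ⟨h1', h2', h3'⟩ := h'
      have ha : a = a' := by
        rw [h1] at h1'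
        cases a <;> cases a' <;> first | rfl | norm_num at h1'
      have hll : l = l' := by
        rcases h2 with ⟨e, h2⟩ | ⟨h2, k⟩ <;> rcases h2' with ⟨e', h2'⟩ | ⟨h2', k'⟩
        · rw [e, e']
        · rw [h2] at h2'; norm_num at h2'
        · rw [h2] at h2'; norm_num at h2'
        · exact hl k k'
      have hrr : r = r' := by
        rcases h3 with ⟨e, h3⟩ | ⟨h3, k⟩ <;> rcases h3' with ⟨e', h3'⟩ | ⟨h3', k'⟩
        · rw [e, e']
        · rw [h3] at h3'; norm_num at h3'
        · rw [h3] at h3'; norm_num at h3'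
        · exact hr k k'
      rw [ha, hll, hrr]

theorem cast_flow_node (a : Bool) (l r : BinaryTree Bool) :
    (flow (.node a l r) : ℝ) = max ((flow l : ℝ) + flow r + (if a then 1 else -1)) 0 := by
  cases a
  · simp only [flow, Bool.false_eq_true, if_false]
    rcases Nat.eq_zero_or_pos (flow l + flow r) with h | h
    · have h1 : flow l = 0 := by omega
      have h2 : flow r = 0 := by omega
      simp [h1, h2]
    · rw [Nat.cast_sub h]
      have : (1 : ℝ) ≤ flow l + flow r := by exact_mod_cast h
      rw [max_eq_left (by linarith)]; push_cast; ring
  · simp only [flow, if_true]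
    rw [max_eq_left (by positivity)]; push_cast; ring

theorem truncRunoff_le_of_realizes {t : BinaryTree Bool} {v : List Bool} (h : Realizes x c t v)
    (n : ℕ) : truncRunoff x c n v ≤ flow t := by
  induction t generalizing v n with
  | nil => exact h.elim
  | node a l r hl hr =>
    obtain ⟨h1, h2, h3⟩ := h
    have e {b : Bool} {s : BinaryTree Bool} (hs : (s = .nil ∧ c v b = 0) ∨
        (c v b = 1 ∧ Realizes x c s (b :: v)))
        (ih : ∀ {v : List Bool}, Realizes x c s v → ∀ n, truncRunoff x c n v ≤ flow s) (n : ℕ) :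
        c v b * truncRunoff x c n (b :: v) ≤ flow s := by
      rcases hs with ⟨_, h⟩ | ⟨h, k⟩
      · rw [h, zero_mul]; positivity
      · rw [h, one_mul]; exact ih k n
    rw [cast_flow_node]
    cases n with
    | zero =>
      rw [truncRunoff, h1]
      exact max_le_max (le_add_of_nonneg_left (by positivity)) le_rfl
    | succ n =>
      rw [truncRunoff, h1]
      exact max_le_max (add_le_add_left (add_le_add (e h2 hl n) (e h3 hr n)) _) le_rfl

theorem truncRunoff_eq_of_realizes {t : BinaryTree Bool} {v : List Bool} (h : Realizes x c t v)
    {n : ℕ} (hn : t.height ≤ n) : truncRunoff x c n v = flow t := by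
  induction t generalizing v n with
  | nil => exact h.elim
  | node a l r hl hr =>
    obtain ⟨h1, h2, h3⟩ := h
    cases n with
    | zero => simp at hn
    | succ n =>
      simp only [BinaryTree.height, max_le_iff, Order.add_one_le_iff,
        Nat.lt_succ_iff] at hn
      rw [cast_flow_node, truncRunoff, h1]
      have e {b : Bool} {s : BinaryTree Bool} (hs : (s = .nil ∧ c v b = 0) ∨
          (c v b = 1 ∧ Realizes x c s (b :: v)))
          (ih : ∀ {v : List Bool}, Realizes x c s v → ∀ {n}, s.height ≤ n →
            truncRunoff x c n v = flow s) (hsn : s.height ≤ n) :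
          c v b * truncRunoff x c n (b :: v) = flow s := by
        rcases hs with ⟨hs, h⟩ | ⟨h, k⟩
        · rw [h, zero_mul, hs, flow, Nat.cast_zero]
        · rw [h, one_mul]; exact ih k hsn
      rw [e h2 hl (by omega), e h3 hr (by omega)]

theorem runoff_eq_of_realizes {t : BinaryTree Bool} {v : List Bool} (h : Realizes x c t v) :
    runoff x c v = flow t := by
  rw [← ENNReal.ofReal_natCast]
  refine le_antisymm (iSup_le fun n => ENNReal.ofReal_le_ofReal (truncRunoff_le_of_realizes h n)) ?_
  rw [← truncRunoff_eq_of_realizes h le_rfl]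
  exact le_iSup (fun n => ENNReal.ofReal (truncRunoff x c n v)) _

theorem netContribution_eq_of_realizes {t : BinaryTree Bool} (h : Realizes x c t []) :
    netContribution x c = net t := by
  have h0 := runoff_eq_of_realizes h
  cases t with
  | nil => exact h.elim
  | node a l r =>
    obtain ⟨h1, h2, h3⟩ := h
    have e {b : Bool} {s : BinaryTree Bool} (hs : (s = .nil ∧ c [] b = 0) ∨
        (c [] b = 1 ∧ Realizes x c s [b])) : (runoff x c [b]).toReal * c [] b = flow s := by
      rcases hs with ⟨hs, h⟩ | ⟨h, k⟩
      · rw [h, mul_zero, hs, flow, Nat.cast_zero]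
      · rw [h, mul_one, runoff_eq_of_realizes k, ENNReal.toReal_natCast]
    rw [netContribution, h0, e h2, e h3, ENNReal.toReal_natCast, net]

/-- Cells are words extended at the head, so `InTree` peels from the top down, whereas recursion on
a finite tree starts at the root. `UpPath` is the rootward-to-upward form; keeping the starting cell
v general makes the induction close. -/
theorem inTree_reverse_append (A : List Bool → Prop) (p v : List Bool) :
    (InTree c (p.reverse ++ v) ∧ ∀ u, u <:+ p.reverse ++ v → A u) ↔
      (InTree c v ∧ ∀ u, u <:+ v → u ≠ v → A u) ∧ UpPath A c v p := by
  have split (v : List Bool) : (∀ u, u <:+ v → A u) ↔ (∀ u, u <:+ v → u ≠ v → A u) ∧ A v :=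
    ⟨fun h => ⟨fun u hu _ => h u hu, h v List.suffix_rfl⟩, fun h u hu => by
      by_cases e : u = v
      · exact e ▸ h.2
      · exact h.1 u hu e⟩
  induction p generalizing v with
  | nil =>
    rw [List.reverse_nil, List.nil_append, split, UpPath, and_assoc]
  | cons b p ih =>
    have e : (∀ u, u <:+ b :: v → u ≠ b :: v → A u) ↔ ∀ u, u <:+ v → A u := by
      refine forall_congr' fun u => ⟨fun h hu => h (hu.trans (List.suffix_cons b v)) ?_,
        fun h hu hne => h ((List.suffix_cons_iff.1 hu).resolve_left hne)⟩
      rintro rfl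
      simpa using hu.length_le
    rw [List.reverse_cons, List.append_assoc, List.singleton_append]
    refine (ih (b :: v)).trans ?_
    rw [e, split, UpPath, InTree]
    tauto

theorem contributes_reverse (p : List Bool) :
    Contributes x c p.reverse ↔ UpPath (fun u => 0 < runoff x c u) c [] p := by
  have h := inTree_reverse_append (c := c) (fun u => 0 < runoff x c u) p []
  rw [List.append_nil] at h
  rw [Contributes, h]
  simp +contextual [InTree]

theorem inTree_reverse (p : List Bool) :
    InTree c p.reverse ↔ UpPath (fun _ => True) c [] p := by
  have h := inTree_reverse_append (c := c) (fun _ => True) p []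
  simpa [InTree] using h

/-- The nodes of an upward path are distinct and all contribute; there is one more of them than
edges. -/
theorem length_lt_cluster {t : BinaryTree Bool} {v p : List Bool} (h : Realizes x c t v)
    (hp : UpPath (fun u => 0 < runoff x c u) c v p) : p.length < cluster t := by
  induction t generalizing v p with
  | nil => exact h.elim
  | node a l r hl hr =>
    have h0 := runoff_eq_of_realizes h
    obtain ⟨h1, h2, h3⟩ := h
    cases p with
    | nil =>
      rw [UpPath, h0] at hp
      have : flow (.node a l r) ≠ 0 := by rintro e; simp [e] at hp
      simp [cluster, this]
    | cons b p =>
      obtain ⟨hp0, hb, hp⟩ := hp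
      rw [h0] at hp0
      have : flow (.node a l r) ≠ 0 := by rintro e; simp [e] at hp0
      rw [cluster, if_neg this, List.length_cons]
      cases b
      · rcases h2 with ⟨_, h2⟩ | ⟨_, k⟩
        · rw [h2] at hb; norm_num at hb
        · have := hl k hp; omega
      · rcases h3 with ⟨_, h3⟩ | ⟨_, k⟩
        · rw [h3] at hb; norm_num at hb
        · have := hr k hp; omega

theorem exists_upPath_of_reaches {t : BinaryTree Bool} {v : List Bool} {j : ℕ}
    (h : Realizes x c t v) (hj : Reaches j t) :
    ∃ p, p.length = j ∧ UpPath (fun u => 0 < runoff x c u) c v p := by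
  induction t generalizing v j with
  | nil => exact h.elim
  | node a l r hl hr =>
    have h0 := runoff_eq_of_realizes h
    obtain ⟨h1, h2, h3⟩ := h
    cases j with
    | zero => exact ⟨[], rfl, by rw [UpPath, h0]; exact_mod_cast hj⟩
    | succ j =>
      obtain ⟨h4, h5⟩ := hj
      have h4' : 0 < runoff x c v := by rw [h0]; exact_mod_cast h4
      have hnil : ¬ Reaches j .nil := by cases j <;> simp [Reaches, flow]
      rcases h5 with h5 | h5
      · rcases h2 with ⟨e, _⟩ | ⟨e, k⟩
        · exact absurd (e ▸ h5) hnil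
        · obtain ⟨p, rfl, hp⟩ := hl k h5
          exact ⟨false :: p, rfl, h4', e, hp⟩
      · rcases h3 with ⟨e, _⟩ | ⟨e, k⟩
        · exact absurd (e ▸ h5) hnil
        · obtain ⟨p, rfl, hp⟩ := hr k h5
          exact ⟨true :: p, rfl, h4', e, hp⟩

theorem length_lt_height {t : BinaryTree Bool} {v p : List Bool} (h : Realizes x c t v)
    (hp : UpPath (fun _ => True) c v p) : p.length < t.height := by
  induction t generalizing v p with
  | nil => exact h.elim
  | node a l r hl hr =>
    obtain ⟨h1, h2, h3⟩ := h
    rw [BinaryTree.height]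
    cases p with
    | nil => simp
    | cons b p =>
      obtain ⟨-, hb, hp⟩ := hp
      rw [List.length_cons]
      cases b
      · rcases h2 with ⟨_, h2⟩ | ⟨_, k⟩
        · rw [h2] at hb; norm_num at hb
        · have := hl k hp; omega
      · rcases h3 with ⟨_, h3⟩ | ⟨_, k⟩
        · rw [h3] at hb; norm_num at hb
        · have := hr k hp; omega

theorem exists_upPath_height {t : BinaryTree Bool} {v : List Bool} (h : Realizes x c t v) :
    ∃ p, p.length + 1 = t.height ∧ UpPath (fun _ => True) c v p := by
  induction t generalizing v with
  | nil => exact h.elim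
  | node a l r hl hr =>
    obtain ⟨h1, h2, h3⟩ := h
    rw [BinaryTree.height]
    by_cases h0 : l = .nil ∧ r = .nil
    · exact ⟨[], by simp [h0.1, h0.2], trivial⟩
    rcases le_total r.height l.height with hlr | hlr
    · rcases h2 with ⟨e, _⟩ | ⟨e, k⟩
      · refine absurd ⟨e, ?_⟩ h0
        cases r with
        | nil => rfl
        | node => simp [e] at hlr
      · obtain ⟨p, hp, hp'⟩ := hl k
        exact ⟨false :: p, by simp [hp, hlr], trivial, e, hp'⟩
    · rcases h3 with ⟨e, _⟩ | ⟨e, k⟩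
      · refine absurd ⟨?_, e⟩ h0
        cases l with
        | nil => rfl
        | node => simp [e] at hlr
      · obtain ⟨p, hp, hp'⟩ := hr k
        exact ⟨true :: p, by simp [hp, hlr], trivial, e, hp'⟩

/-- The shift by one arises because `BinaryTree.height` counts levels while generations start at 0.
-/
theorem treeHeight_eq_of_realizes {t : BinaryTree Bool} (h : Realizes x c t []) :
    treeHeight c = ((t.height - 1 : ℕ) : ℕ∞) := by
  refine le_antisymm (iSup₂_le fun v hv => ?_) ?_
  · rw [← List.reverse_reverse v, inTree_reverse] at hv
    have := length_lt_height h hv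
    rw [List.length_reverse] at this
    exact_mod_cast Nat.le_sub_one_of_lt this
  · obtain ⟨p, hp, hp'⟩ := exists_upPath_height h
    rw [← hp, Nat.add_sub_cancel, ← List.length_reverse]
    exact le_iSup₂ (f := fun v (_ : InTree c v) => (v.length : ℕ∞)) p.reverse
      ((inTree_reverse p).2 hp')

theorem treeHeight_eq_iff_of_realizes {t : BinaryTree Bool} (h : Realizes x c t []) (n : ℕ) :
    treeHeight c = n ↔ t ∈ level n := by
  rw [treeHeight_eq_of_realizes h, mem_level, Nat.cast_inj]
  have : 0 < t.height := by
    cases t with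
    | nil => exact h.elim
    | node => simp
  omega

theorem contributingHeight_le_of_realizes {t : BinaryTree Bool} (h : Realizes x c t []) :
    contributingHeight x c ≤ cluster t := by
  refine iSup₂_le fun v hv => ?_
  rw [← List.reverse_reverse v, contributes_reverse] at hv
  have := length_lt_cluster h hv
  rw [List.length_reverse] at this
  exact_mod_cast this.le

theorem bottomContributes_of_realizes {t : BinaryTree Bool} (h : Realizes x c t []) {n j : ℕ}
    {δ : ℝ} (ht : t ∈ level n) (hj : Reaches j t) (hδ : (1 - δ) * n ≤ j) :
    BottomContributes x c δ := by
  obtain ⟨p, hp, hp'⟩ := exists_upPath_of_reaches h hj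
  exact ⟨n, (treeHeight_eq_iff_of_realizes h n).2 ht, p.reverse, (contributes_reverse p).2 hp',
    by rw [List.length_reverse, hp]; exact hδ⟩

theorem abs_net_le (t : BinaryTree Bool) : |net t| ≤ 1 := by
  cases t with
  | nil => simp [net]
  | node a l r =>
    have h1 : (0 : ℝ) ≤ flow l := Nat.cast_nonneg _
    have h2 : (0 : ℝ) ≤ flow r := Nat.cast_nonneg _
    rw [net, cast_flow_node, abs_le]
    cases a
    · simp only [Bool.false_eq_true, if_false]
      constructor
      · linarith [le_max_left ((flow l : ℝ) + flow r + -1) 0]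
      · rw [sub_le_iff_le_add]; exact max_le (by linarith) (by linarith)
    · simp only [if_true]
      rw [max_eq_left (by linarith)]
      constructor <;> linarith

end

/-! ### The law of the drainage tree -/

instance : MeasurableSpace (BinaryTree Bool) := ⊤

instance : DiscreteMeasurableSpace (BinaryTree Bool) := ⟨fun _ => trivial⟩

/-- The cell to which a variable of the model belongs. -/
def cellOf : List Bool ⊕ (List Bool × Bool) → List Bool := Sum.elim id Prod.fst

/-- The variables of the cells above `v`, including `v`. -/
def above (v : List Bool) : Set (List Bool ⊕ (List Bool × Bool)) := {i | v <:+ cellOf i}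

section

variable {Ω : Type*} [mΩ : MeasurableSpace Ω] {P : Measure Ω} {α β : ℝ}
  {X : List Bool → Ω → ℝ} {I : List Bool → Bool → Ω → ℝ}

/-- The variables of the model as a single family. -/
def vars (X : List Bool → Ω → ℝ) (I : List Bool → Bool → Ω → ℝ) :
    List Bool ⊕ (List Bool × Bool) → Ω → ℝ :=
  Sum.elim X (fun e : List Bool × Bool => I e.1 e.2)

/-- The σ-algebra generated by the variables with index in `S`. -/
@[reducible] def sigmaOf (X : List Bool → Ω → ℝ) (I : List Bool → Bool → Ω → ℝ)
    (S : Set (List Bool ⊕ (List Bool × Bool))) : MeasurableSpace Ω :=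
  ⨆ i ∈ S, MeasurableSpace.comap (vars X I i) inferInstance

omit mΩ in
theorem sigmaOf_mono {S T : Set (List Bool ⊕ (List Bool × Bool))} (h : S ⊆ T) :
    sigmaOf X I S ≤ sigmaOf X I T :=
  biSup_mono h

omit mΩ in
theorem measurableSet_vars_eq {S : Set (List Bool ⊕ (List Bool × Bool))}
    {i : List Bool ⊕ (List Bool × Bool)} (hi : i ∈ S) (a : ℝ) :
    MeasurableSet[sigmaOf X I S] {ω | vars X I i ω = a} :=
  le_iSup₂ (f := fun i (_ : i ∈ S) => MeasurableSpace.comap (vars X I i) inferInstance) i hi _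
    ⟨{a}, measurableSet_singleton a, rfl⟩

/-- The event that the drainage tree of `v` is `t`. -/
def treeEvent (X : List Bool → Ω → ℝ) (I : List Bool → Bool → Ω → ℝ) (v : List Bool)
    (t : BinaryTree Bool) : Set Ω :=
  {ω | Realizes (fun v => X v ω) (fun v b => I v b ω) t v}

/-- The event that the edge from `b :: v` to `v` carries the tree `t`. -/
def edgeEvent (X : List Bool → Ω → ℝ) (I : List Bool → Bool → Ω → ℝ) (v : List Bool) (b : Bool)
    (t : BinaryTree Bool) : Set Ω :=
  {ω | (t = .nil ∧ I v b ω = 0) ∨ (I v b ω = 1 ∧ ω ∈ treeEvent X I (b :: v) t)}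

/-- The variables that determine what is carried by the edge from `b :: v` to `v`. -/
def edgeVars (v : List Bool) (b : Bool) : Set (List Bool ⊕ (List Bool × Bool)) :=
  {Sum.inr (v, b)} ∪ above (b :: v)

theorem not_cons_suffix (b : Bool) (v : List Bool) : ¬ b :: v <:+ v := fun h => by
  simpa using h.length_le

theorem above_cons_subset (b : Bool) (v : List Bool) : above (b :: v) ⊆ above v :=
  fun _ h => (List.suffix_cons b v).trans h

theorem edgeVars_subset (v : List Bool) (b : Bool) : edgeVars v b ⊆ above v :=
  Set.union_subset (Set.singleton_subset_iff.2 (List.suffix_rfl : v <:+ v))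
    (above_cons_subset b v)

omit mΩ in
theorem measurableSet_edgeEvent_of {v : List Bool} {b : Bool} {t : BinaryTree Bool}
    (h : MeasurableSet[sigmaOf X I (above (b :: v))] (treeEvent X I (b :: v) t)) :
    MeasurableSet[sigmaOf X I (edgeVars v b)] (edgeEvent X I v b t) := by
  have hi : (Sum.inr (v, b) : List Bool ⊕ (List Bool × Bool)) ∈ edgeVars v b := Or.inl rfl
  have h0 : MeasurableSet[sigmaOf X I (edgeVars v b)] {ω | I v b ω = 0} :=
    measurableSet_vars_eq hi 0
  have h1 : MeasurableSet[sigmaOf X I (edgeVars v b)] {ω | I v b ω = 1} :=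
    measurableSet_vars_eq hi 1
  have h2 := sigmaOf_mono (Set.subset_union_right : above (b :: v) ⊆ edgeVars v b) _ h
  exact ((@MeasurableSet.const Ω (sigmaOf X I (edgeVars v b)) (t = .nil)).inter h0).union
    (h1.inter h2)

omit mΩ in
theorem measurableSet_treeEvent_above (v : List Bool) (t : BinaryTree Bool) :
    MeasurableSet[sigmaOf X I (above v)] (treeEvent X I v t) := by
  induction t generalizing v with
  | nil => exact @MeasurableSet.empty Ω (sigmaOf X I (above v))
  | node a l r hl hr =>
    have h0 : MeasurableSet[sigmaOf X I (above v)] {ω | X v ω = if a then 1 else -1} :=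
      measurableSet_vars_eq (i := Sum.inl v) (List.suffix_rfl : v <:+ v) _
    exact h0.inter ((sigmaOf_mono (edgeVars_subset v false) _
      (measurableSet_edgeEvent_of (hl _))).inter (sigmaOf_mono (edgeVars_subset v true) _
      (measurableSet_edgeEvent_of (hr _))))

omit mΩ in
theorem measurableSet_edgeEvent (v : List Bool) (b : Bool) (t : BinaryTree Bool) :
    MeasurableSet[sigmaOf X I (edgeVars v b)] (edgeEvent X I v b t) :=
  measurableSet_edgeEvent_of (measurableSet_treeEvent_above _ t)

theorem disjoint_edgeVars (v : List Bool) : Disjoint (edgeVars v false) (edgeVars v true) := by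
  rw [Set.disjoint_left]
  rintro i (rfl | h) (h' | h')
  · simp at h'
  · exact not_cons_suffix _ _ h'
  · subst h'; exact not_cons_suffix _ _ h
  · have := (List.suffix_of_suffix_length_le h h' (by simp)).eq_of_length (by simp)
    simp at this

theorem disjoint_vertexVar (v : List Bool) :
    Disjoint ({Sum.inl v} : Set (List Bool ⊕ (List Bool × Bool)))
      (edgeVars v false ∪ edgeVars v true) := by
  rw [Set.disjoint_singleton_left]
  rintro ((h | h) | (h | h))
  · simp at h
  · exact not_cons_suffix _ _ h
  · simp at h
  · exact not_cons_suffix _ _ h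

variable (hM : IsModel P α β X I)
include hM

theorem IsModel.sigmaOf_le (S : Set (List Bool ⊕ (List Bool × Bool))) : sigmaOf X I S ≤ mΩ := by
  refine iSup₂_le fun i _ => Measurable.comap_le ?_
  cases i with
  | inl v => exact hM.measurable_X v
  | inr e => exact hM.measurable_I e.1 e.2

theorem IsModel.measure_inter {S T : Set (List Bool ⊕ (List Bool × Bool))} (hST : Disjoint S T)
    {A B : Set Ω} (hA : MeasurableSet[sigmaOf X I S] A) (hB : MeasurableSet[sigmaOf X I T] B) :
    P (A ∩ B) = P A * P B := by
  have h := indep_iSup_of_disjoint (m := fun i => MeasurableSpace.comap (vars X I i) inferInstance)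
    (μ := P) (fun i => ?_) hM.indep hST
  · exact (Indep_iff _ _ _).1 h A B hA hB
  · simpa [sigmaOf] using hM.sigmaOf_le {i}

theorem IsModel.measurableSet_treeEvent (v : List Bool) (t : BinaryTree Bool) :
    MeasurableSet (treeEvent X I v t) :=
  hM.sigmaOf_le _ _ (measurableSet_treeEvent_above v t)

theorem IsModel.measure_edgeEvent {v : List Bool} {b : Bool} {t : BinaryTree Bool} {p : ℝ}
    (hp : 0 ≤ p) (h1 : P {ω | I v b ω = 1} = ENNReal.ofReal p)
    (h0 : P {ω | I v b ω = 0} = ENNReal.ofReal (1 - p))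
    (ht : P (treeEvent X I (b :: v) t) = ENNReal.ofReal (weight α β t)) :
    P (edgeEvent X I v b t) = ENNReal.ofReal (edgeWeight p (weight α β t) t) := by
  by_cases hn : t = .nil
  · subst hn
    have : edgeEvent X I v b .nil = {ω | I v b ω = 0} := by
      ext ω; simp [edgeEvent, treeEvent, Realizes]
    rw [this, h0]; simp [edgeWeight, weight]
  · have : edgeEvent X I v b t = {ω | I v b ω = 1} ∩ treeEvent X I (b :: v) t := by
      ext ω; simp [edgeEvent, hn]
    have hd : Disjoint ({Sum.inr (v, b)} : Set (List Bool ⊕ (List Bool × Bool)))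
        (above (b :: v)) := Set.disjoint_singleton_left.2 (not_cons_suffix b v)
    have hI : MeasurableSet[sigmaOf X I {Sum.inr (v, b)}] {ω | I v b ω = 1} :=
      measurableSet_vars_eq (X := X) (I := I) (Set.mem_singleton (Sum.inr (v, b))) 1
    rw [this, hM.measure_inter hd hI (measurableSet_treeEvent_above _ _), h1, ht,
      ← ENNReal.ofReal_mul hp]
    simp [edgeWeight, hn]

variable (hα : 0 < α ∧ α < 1) (hβ : 0 < β ∧ β ≤ 1 / 2)
include hα hβ

/-- The root contribution and the two edges, with all that lies above them, depend on disjoint sets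
of variables, so the probability factorizes as `weight` does. -/
theorem IsModel.measure_treeEvent (v : List Bool) (t : BinaryTree Bool) :
    P (treeEvent X I v t) = ENNReal.ofReal (weight α β t) := by
  induction t generalizing v with
  | nil => simp [treeEvent, Realizes, weight]
  | node a l r hl hr =>
    have e : treeEvent X I v (.node a l r) = {ω | X v ω = if a then 1 else -1} ∩
        (edgeEvent X I v false l ∩ edgeEvent X I v true r) := rfl
    have ha : P {ω | X v ω = if a then 1 else -1} = ENNReal.ofReal (pointWeight α a) := by
      cases a
      · simpa [pointWeight] using hM.X_neg v
      · simpa [pointWeight] using hM.X_pos v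
    have h1 : 0 ≤ 1 - β := by linarith [hβ.2]
    have hX : MeasurableSet[sigmaOf X I {Sum.inl v}] {ω | X v ω = if a then 1 else -1} :=
      measurableSet_vars_eq (X := X) (I := I) (Set.mem_singleton (Sum.inl v)) _
    rw [e, hM.measure_inter (disjoint_vertexVar v) hX
      ((sigmaOf_mono Set.subset_union_left _ (measurableSet_edgeEvent v false l)).inter
        (sigmaOf_mono Set.subset_union_right _ (measurableSet_edgeEvent v true r))),
      hM.measure_inter (disjoint_edgeVars v) (measurableSet_edgeEvent v false l)
        (measurableSet_edgeEvent v true r),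
      hM.measure_edgeEvent h1 (hM.left_open v) (by rw [hM.left_closed v, sub_sub_cancel]) (hl _),
      hM.measure_edgeEvent hβ.1.le (hM.right_open v) (hM.right_closed v) (hr _), ha, weight,
      ENNReal.ofReal_mul (pointWeight_nonneg hα a),
      ENNReal.ofReal_mul (edgeWeight_nonneg h1 (by linarith [hβ.1]) (weight_nonneg hα hβ l) l)]

variable [IsProbabilityMeasure P]

/-- The events for different trees are disjoint and their probabilities sum to lim `gen` at 1, which
is 1. -/
theorem IsModel.ae_exists_realizes (v : List Bool) :
    ∀ᵐ ω ∂P, ∃ t, Realizes (fun v => X v ω) (fun v b => I v b ω) t v := by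
  have hU : {ω | ∃ t, Realizes (fun v => X v ω) (fun v b => I v b ω) t v} =
      ⋃ t, treeEvent X I v t := by
    ext ω; simp [treeEvent]
  have hd : Pairwise (Function.onFun Disjoint (treeEvent X I v)) := fun t t' h =>
    Set.disjoint_left.2 fun ω h1 h2 => h (h1.unique h2)
  refine (mem_ae_iff_prob_eq_one ?_).2 ?_
  · rw [hU]; exact MeasurableSet.iUnion (hM.measurableSet_treeEvent v)
  · rw [hU]
    refine le_antisymm prob_le_one ?_
    rw [measure_iUnion hd (hM.measurableSet_treeEvent v)]
    have h1 : Tendsto (fun n => ENNReal.ofReal (gen α β n 1)) atTop (𝓝 1) := by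
      simpa using ENNReal.tendsto_ofReal (tendsto_gen_one hα hβ)
    refine le_of_tendsto' h1 fun n => ?_
    simp only [hM.measure_treeEvent hα hβ]
    refine le_trans (le_of_eq ?_) (ENNReal.sum_le_tsum (trees n))
    rw [← ENNReal.ofReal_sum_of_nonneg fun t _ => weight_nonneg hα hβ t]
    simp [gen, ex]

end

/-! ### The random drainage tree and the transfer of the estimates to the model -/

section

variable {Ω : Type*} [mΩ : MeasurableSpace Ω] {P : Measure Ω} {α β : ℝ}
  {X : List Bool → Ω → ℝ} {I : List Bool → Bool → Ω → ℝ}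

open Classical in
/-- The drainage tree of the root, `nil` if it is infinite. -/
noncomputable def treeOf (X : List Bool → Ω → ℝ) (I : List Bool → Bool → Ω → ℝ) (ω : Ω) :
    BinaryTree Bool :=
  if h : ∃ t, Realizes (fun v => X v ω) (fun v b => I v b ω) t [] then h.choose else .nil

omit mΩ in
theorem treeOf_eq {ω : Ω} {t : BinaryTree Bool}
    (h : Realizes (fun v => X v ω) (fun v b => I v b ω) t []) : treeOf X I ω = t := by
  have h' : ∃ t, Realizes (fun v => X v ω) (fun v b => I v b ω) t [] := ⟨t, h⟩
  rw [treeOf, dif_pos h']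
  exact h'.choose_spec.unique h

omit mΩ in
theorem preimage_treeOf_singleton {t : BinaryTree Bool} (ht : t ≠ .nil) :
    treeOf X I ⁻¹' {t} = treeEvent X I [] t := by
  ext ω
  refine ⟨fun h => ?_, fun h => treeOf_eq h⟩
  by_cases h' : ∃ t, Realizes (fun v => X v ω) (fun v b => I v b ω) t []
  · obtain ⟨t', h'⟩ := h'
    have : t' = t := (treeOf_eq h').symm.trans h
    exact this ▸ h'
  · have : treeOf X I ω = .nil := dif_neg h'
    exact absurd (h.symm.trans this) ht

variable (hM : IsModel P α β X I)
include hM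

theorem IsModel.measurable_treeOf : Measurable (treeOf X I) := by
  have h1 : ∀ t, t ≠ .nil → MeasurableSet (treeOf X I ⁻¹' {t}) := fun t ht => by
    rw [preimage_treeOf_singleton ht]; exact hM.measurableSet_treeEvent [] t
  refine measurable_to_countable' fun t => ?_
  by_cases ht : t = .nil
  · have : treeOf X I ⁻¹' {t} = (⋃ s : {s : BinaryTree Bool // s ≠ .nil},
        treeOf X I ⁻¹' {s.1})ᶜ := by
      ext ω; subst ht; simp [not_imp_not]
    rw [this]
    exact (MeasurableSet.iUnion fun s : {s : BinaryTree Bool // s ≠ .nil} =>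
      h1 s.1 s.2).compl
  · exact h1 t ht

variable (hα : 0 < α ∧ α < 1) (hβ : 0 < β ∧ β ≤ 1 / 2) [IsProbabilityMeasure P]
include hα hβ

theorem IsModel.ae_realizes_treeOf :
    ∀ᵐ ω ∂P, Realizes (fun v => X v ω) (fun v b => I v b ω) (treeOf X I ω) [] := by
  filter_upwards [hM.ae_exists_realizes hα hβ []] with ω ⟨t, ht⟩
  rwa [treeOf_eq ht]

theorem IsModel.map_treeOf_singleton (t : BinaryTree Bool) :
    P.map (treeOf X I) {t} = ENNReal.ofReal (weight α β t) := by
  rw [Measure.map_apply hM.measurable_treeOf (measurableSet_singleton t)]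
  by_cases ht : t = .nil
  · subst ht
    rw [weight, ENNReal.ofReal_zero, measure_eq_zero_iff_ae_notMem]
    filter_upwards [hM.ae_realizes_treeOf hα hβ] with ω h h'
    have h' : treeOf X I ω = .nil := h'
    rw [h'] at h
    exact h
  · rw [preimage_treeOf_singleton ht, hM.measure_treeEvent hα hβ]

theorem IsModel.setLIntegral_map_treeOf (S : Finset (BinaryTree Bool)) {φ : BinaryTree Bool → ℝ}
    (hφ : ∀ t, 0 ≤ φ t) : ∫⁻ t in S, ENNReal.ofReal (φ t) ∂(P.map (treeOf X I)) =
      ENNReal.ofReal (∑ t ∈ S, weight α β t * φ t) := by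
  rw [lintegral_finset, ENNReal.ofReal_sum_of_nonneg fun t _ =>
    mul_nonneg (weight_nonneg hα hβ t) (hφ t)]
  refine Finset.sum_congr rfl fun t _ => ?_
  rw [hM.map_treeOf_singleton hα hβ, ENNReal.ofReal_mul (weight_nonneg hα hβ t), mul_comm]

theorem IsModel.height_ae_eq (n : ℕ) :
    {ω | treeHeight (fun v b => I v b ω) = n} =ᵐ[P] treeOf X I ⁻¹' (level n) := by
  filter_upwards [hM.ae_realizes_treeOf hα hβ] with ω h
  exact propext (treeHeight_eq_iff_of_realizes h n)

/-- The height event need not be shown measurable: it agrees almost everywhere with a measurable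
preimage, which determines both the restriction and the normalization. -/
theorem IsModel.cond_height (n : ℕ) :
    cond P {ω | treeHeight (fun v b => I v b ω) = n} =
      (ENNReal.ofReal (exLevel α β n fun _ => 1))⁻¹ •
        P.restrict (treeOf X I ⁻¹' (level n)) := by
  have h := hM.height_ae_eq hα hβ n
  have h1 := hM.setLIntegral_map_treeOf hα hβ (level n) (φ := fun _ => 1) fun _ => zero_le_one
  rw [ENNReal.ofReal_one, setLIntegral_one, Measure.map_apply hM.measurable_treeOf
    (MeasurableSet.of_discrete)] at h1
  rw [ProbabilityTheory.cond, Measure.restrict_congr_set h, measure_congr h, h1, exLevel]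

theorem IsModel.le_measure_bottomContributes {n j : ℕ} {δ : ℝ} (hδ : (1 - δ) * n ≤ j) :
    ENNReal.ofReal (exLevel α β n (reachInd j)) ≤
      P.restrict (treeOf X I ⁻¹' (level n))
        {ω | BottomContributes (fun v => X v ω) (fun v b => I v b ω) δ} := by
  have hm := hM.measurable_treeOf
  have hL : MeasurableSet (level n : Set (BinaryTree Bool)) := .of_discrete
  have hR : MeasurableSet {t | Reaches j t} := .of_discrete
  rw [Measure.restrict_apply' (hm hL)]
  have h1 : ENNReal.ofReal (exLevel α β n (reachInd j)) =
      P (treeOf X I ⁻¹' {t | Reaches j t} ∩ treeOf X I ⁻¹' (level n)) := by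
    rw [exLevel, ← hM.setLIntegral_map_treeOf hα hβ (level n) (reachInd_nonneg j),
      ← Set.preimage_inter, ← Measure.map_apply hm (hR.inter hL), ← Measure.restrict_apply hR,
      ← lintegral_indicator_one hR]
    refine lintegral_congr fun t => ?_
    by_cases ht : Reaches j t <;> simp [reachInd, ht]
  rw [h1]
  -- Almost sure inclusion is enough, so measurability of the contribution event is not needed.
  refine measure_mono_ae ?_
  filter_upwards [hM.ae_realizes_treeOf hα hβ] with ω h ⟨h2, h3⟩
  exact ⟨bottomContributes_of_realizes h h3 h2 hδ, h3⟩

theorem IsModel.ae_contributingHeight_le :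
    ∀ᵐ ω ∂P, ((contributingHeight (fun v => X v ω) (fun v b => I v b ω) : ℕ∞) : ℝ≥0∞) ≤
      ENNReal.ofReal (cluster (treeOf X I ω)) := by
  filter_upwards [hM.ae_realizes_treeOf hα hβ] with ω h
  rw [ENNReal.ofReal_natCast, ← ENat.toENNReal_coe]
  exact ENat.toENNReal_mono (contributingHeight_le_of_realizes h)

theorem IsModel.setLIntegral_contributingHeight_le (n : ℕ) :
    ∫⁻ ω in treeOf X I ⁻¹' (level n),
      (contributingHeight (fun v => X v ω) (fun v b => I v b ω) : ℝ≥0∞) ∂P ≤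
    ENNReal.ofReal (exLevel α β n fun t => cluster t) := by
  have hm := hM.measurable_treeOf
  refine (lintegral_mono_ae (ae_restrict_of_ae (hM.ae_contributingHeight_le hα hβ))).trans ?_
  rw [exLevel, ← hM.setLIntegral_map_treeOf hα hβ (level n) (fun t => Nat.cast_nonneg _),
    setLIntegral_map .of_discrete .of_discrete hm]

theorem IsModel.lintegral_contributingHeight_le {B : ℝ}
    (hB : ∀ n, ex α β n (fun t => (cluster t : ℝ)) ≤ B) :
    ∫⁻ ω, (contributingHeight (fun v => X v ω) (fun v b => I v b ω) : ℝ≥0∞) ∂P ≤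
    ENNReal.ofReal B := by
  have hm := hM.measurable_treeOf
  refine (lintegral_mono_ae (hM.ae_contributingHeight_le hα hβ)).trans ?_
  rw [← lintegral_map (f := fun t => ENNReal.ofReal (cluster t)) .of_discrete hm,
    lintegral_countable', ENNReal.tsum_eq_iSup_sum' trees fun s =>
      ⟨s.sup BinaryTree.height, fun t ht => mem_trees.2 (Finset.le_sup ht)⟩]
  refine iSup_le fun n => ?_
  rw [← lintegral_finset, hM.setLIntegral_map_treeOf hα hβ _ (fun t => Nat.cast_nonneg _)]
  exact ENNReal.ofReal_le_ofReal (hB n)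

theorem IsModel.netContribution_ae_eq :
    (fun ω => netContribution (fun v => X v ω) (fun v b => I v b ω)) =ᵐ[P]
      fun ω => net (treeOf X I ω) := by
  filter_upwards [hM.ae_realizes_treeOf hα hβ] with ω h
  exact netContribution_eq_of_realizes h

omit hα hβ in
theorem IsModel.integrable_net : Integrable net (P.map (treeOf X I)) := by
  have := Measure.isProbabilityMeasure_map (μ := P) hM.measurable_treeOf.aemeasurable
  exact Integrable.of_bound (Measurable.of_discrete).aestronglyMeasurable 1
    (ae_of_all _ fun t => by rw [Real.norm_eq_abs]; exact abs_net_le t)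

theorem IsModel.integrable_netContribution :
    Integrable (fun ω => netContribution (fun v => X v ω) (fun v b => I v b ω)) P :=
  ((hM.integrable_net).comp_measurable hM.measurable_treeOf).congr
    (hM.netContribution_ae_eq hα hβ).symm

omit hM hα hβ in
-- The net contribution equals X, except that it is 0 when X = -1 and there is no inflow; the second
-- term corrects for that case.
theorem ex_net (n : ℕ) : ex α β (n + 1) net =
    (2 * α - 1) * offspring β (gen α β n 1) + (1 - α) * offspring β (gen α β n 0) := by
  have key : ∀ x l r, net (.node x l r) =
      nodeProd (fun x => if x then 1 else -1) (fun t => 1 ^ flow t) (fun t => 1 ^ flow t)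
        (.node x l r) +
      nodeProd (fun x => if x then 0 else 1) (fun t => 0 ^ flow t) (fun t => 0 ^ flow t)
        (.node x l r) := by
    intro x l r
    cases x
    · rcases Nat.eq_zero_or_pos (flow l + flow r) with h | h
      · have h1 : flow l = 0 := by omega
        have h2 : flow r = 0 := by omega
        simp [net, nodeProd, flow, h1, h2]
      · simp only [net, nodeProd, flow, Bool.false_eq_true, if_false]
        rw [← pow_add 0, zero_pow h.ne', Nat.cast_sub h]
        push_cast; ring
    · simp [net, nodeProd, flow]
  rw [ex_congr_node (ψ := fun t => nodeProd _ _ _ t + nodeProd _ _ _ t) _ key,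
    ex_add, ex_succ_nodeProd, ex_succ_nodeProd]
  simp only [flow, gen, offspring, pow_zero, if_true, Bool.false_eq_true, if_false]
  ring

theorem IsModel.integral_netContribution :
    ∫ ω, netContribution (fun v => X v ω) (fun v b => I v b ω) ∂P = meanNet α β := by
  have hi := hM.integrable_net
  have hm := hM.measurable_treeOf
  rw [integral_congr_ae (hM.netContribution_ae_eq hα hβ),
    ← integral_map hm.aemeasurable (Measurable.of_discrete).aestronglyMeasurable]
  have hU : (⋃ n, (trees n : Set (BinaryTree Bool))) = Set.univ := by
    ext t; simpa using ⟨t.height, mem_trees.2 le_rfl⟩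
  have h1 := tendsto_setIntegral_of_monotone (μ := P.map (treeOf X I)) (f := net)
    (s := fun n => (trees n : Set (BinaryTree Bool))) (fun _ => .of_discrete)
    (fun m n h => Finset.coe_subset.2 (trees_mono h)) (by rw [hU]; exact hi.integrableOn)
  rw [hU, setIntegral_univ] at h1
  have h2 : ∀ n, ∫ t in (trees n : Set (BinaryTree Bool)), net t ∂(P.map (treeOf X I)) =
      ex α β n net := by
    intro n
    rw [setIntegral_finset _ hi.integrableOn, ex]
    refine Finset.sum_congr rfl fun t _ => ?_
    rw [Measure.real, hM.map_treeOf_singleton hα hβ,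
      ENNReal.toReal_ofReal (weight_nonneg hα hβ t), smul_eq_mul]
  simp only [h2] at h1
  have h3 := h1.comp (tendsto_add_atTop_nat 1)
  refine tendsto_nhds_unique (h3.congr fun n => ex_net n) ?_
  have e1 := (((continuous_offspring (β := β)).tendsto _).comp
    (tendsto_gen_one hα hβ)).const_mul (2 * α - 1)
  have e2 := (((continuous_offspring (β := β)).tendsto _).comp
    (tendsto_gen hα hβ le_rfl zero_le_one)).const_mul (1 - α)
  have e3 := e1.add e2
  rw [show (2 * α - 1) * offspring β 1 + (1 - α) * offspring β (genLim α β 0) = meanNet α β by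
    unfold meanNet offspring; ring] at e3
  exact e3

end

end Runoff

theorem mainTheorem3 {Ω : Type*} [MeasurableSpace Ω] (P : Measure Ω) [IsProbabilityMeasure P]
    (α β : ℝ) (hα : 0 < α ∧ α < 1) (hβ : 0 < β ∧ β ≤ 1 / 2)
    (X : List Bool → Ω → ℝ) (I : List Bool → Bool → Ω → ℝ)
    (hM : Runoff.IsModel P α β X I) :
    -- the drainage tree and all runoffs are almost surely finite
    (∀ᵐ ω ∂P, Runoff.treeHeight (fun v b => I v b ω) ≠ ⊤ ∧
      ∀ v, Runoff.runoff (fun v => X v ω) (fun v b => I v b ω) v ≠ ⊤) ∧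
    -- hence the net contribution at the root is well defined; it is integrable
    Integrable (fun ω => Runoff.netContribution (fun v => X v ω) (fun v b => I v b ω)) P ∧
    -- supercritical case
    (Runoff.alphaC β < α →
      0 < ∫ ω, Runoff.netContribution (fun v => X v ω) (fun v b => I v b ω) ∂P ∧
      ∀ δ : ℝ, 0 < δ → ∃ ε : ℝ, 0 < ε ∧
        ENNReal.ofReal ε ≤
          P {ω | Runoff.BottomContributes (fun v => X v ω) (fun v b => I v b ω) δ} ∧
        ∀ n : ℕ,
          ENNReal.ofReal ε ≤
            cond P {ω | Runoff.treeHeight (fun v b => I v b ω) = n}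
              {ω | Runoff.BottomContributes (fun v => X v ω) (fun v b => I v b ω) δ}) ∧
    -- critical and subcritical cases
    (α ≤ Runoff.alphaC β →
      ∫ ω, Runoff.netContribution (fun v => X v ω) (fun v b => I v b ω) ∂P = 0) ∧
    -- subcritical case
    (α < Runoff.alphaC β →
      ∫⁻ ω, (Runoff.contributingHeight (fun v => X v ω) (fun v b => I v b ω) : ℝ≥0∞) ∂P < ⊤ ∧
      ∃ C : ℝ, ∀ n : ℕ,
        ∫⁻ ω, (Runoff.contributingHeight (fun v => X v ω) (fun v b => I v b ω) : ℝ≥0∞)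
          ∂(cond P {ω | Runoff.treeHeight (fun v b => I v b ω) = n}) ≤ ENNReal.ofReal C) := by
  refine ⟨?_, hM.integrable_netContribution hα hβ, fun h => ⟨?_, fun δ hδ => ?_⟩, fun h => ?_,
    fun h => ?_⟩
  · filter_upwards [ae_all_iff.2 (hM.ae_exists_realizes hα hβ)] with ω hω
    constructor
    · obtain ⟨t, ht⟩ := hω []
      rw [Runoff.treeHeight_eq_of_realizes ht]
      exact ENat.natCast_ne_top _
    · intro v
      obtain ⟨t, ht⟩ := hω v
      rw [Runoff.runoff_eq_of_realizes ht]
      exact ENNReal.natCast_ne_top _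
  · rw [hM.integral_netContribution hα hβ]
    exact Runoff.meanNet_pos hα hβ h
  · obtain ⟨ε, hε, hn⟩ := Runoff.exists_reach hα hβ h hδ
    have hd := Runoff.level_one_pos hα hβ
    have key : ∀ n, ENNReal.ofReal (ε * Runoff.exLevel α β n fun _ => 1) ≤
        P.restrict (Runoff.treeOf X I ⁻¹' (Runoff.level n))
          {ω | Runoff.BottomContributes (fun v => X v ω) (fun v b => I v b ω) δ} := by
      intro n
      obtain ⟨j, hj, hle⟩ := hn n
      exact (ENNReal.ofReal_le_ofReal hle).trans (hM.le_measure_bottomContributes hα hβ hj)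
    -- The second entry serves the unconditional bound, for which the event of height 0 alone is
    -- enough.
    refine ⟨min ε (ε * Runoff.exLevel α β 0 fun _ => 1), lt_min hε (mul_pos hε (hd 0)), ?_,
      fun n => ?_⟩
    · exact (ENNReal.ofReal_le_ofReal (min_le_right _ _)).trans
        ((key 0).trans (Measure.restrict_apply_le _ _))
    · refine (ENNReal.ofReal_le_ofReal (min_le_left _ _)).trans ?_
      rw [hM.cond_height hα hβ, Measure.smul_apply, smul_eq_mul, ← ENNReal.ofReal_inv_of_pos (hd n)]
      refine le_trans (le_of_eq ?_) (mul_le_mul_right (key n) _)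
      rw [← ENNReal.ofReal_mul (inv_nonneg.2 (hd n).le), mul_left_comm,
        inv_mul_cancel₀ (hd n).ne', mul_one]
  · rw [hM.integral_netContribution hα hβ, Runoff.meanNet_eq_zero hα hβ h]
  · obtain ⟨C, hC, hle⟩ := Runoff.exists_cluster_le hα hβ h
    have hd := Runoff.level_one_pos hα hβ
    refine ⟨(hM.lintegral_contributingHeight_le hα hβ (B := C) fun n => ?_).trans_lt
      ENNReal.ofReal_lt_top, C, fun n => ?_⟩
    -- Summing the bound over the heights gives the unconditional one, as the total mass is at most
    -- 1.
    · have h1 : Runoff.ex α β n (fun t => (Runoff.cluster t : ℝ)) ≤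
          C * Runoff.ex α β n fun _ => 1 := by
        induction n with
        | zero => simp [Runoff.ex_zero]
        | succ n ih =>
          rw [Runoff.ex_succ_eq_add, Runoff.ex_succ_eq_add, mul_add]
          exact add_le_add ih (hle n)
      have h2 : Runoff.ex α β n (fun _ => 1) ≤ 1 := by
        simpa [Runoff.gen] using Runoff.gen_one_le hα hβ n
      exact h1.trans (mul_le_of_le_one_right hC h2)
    · rw [hM.cond_height hα hβ, lintegral_smul_measure, smul_eq_mul,
        ← ENNReal.ofReal_inv_of_pos (hd n)]
      refine (mul_le_mul_right ((hM.setLIntegral_contributingHeight_le hα hβ n).trans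
        (ENNReal.ofReal_le_ofReal (hle n))) _).trans (le_of_eq ?_)
      rw [← ENNReal.ofReal_mul (inv_nonneg.2 (hd n).le), mul_left_comm,
        inv_mul_cancel₀ (hd n).ne', mul_one]
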